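/- **Theorem 1.1.** Let $M$ be a smooth Riemannian manifold of dimension $m+1\ge 1$ (Hausdorff, second countable, without boundary), let $\Omega\subseteq M$ be a non-empty connected open set, and let $\mathcal F$ be a transversely orientable codimension-one $C^2$-foliation of $\Omega$. Let $\eta$ be a continuous unit vector field on $\Omega$ normal to the leaves of $\mathcal F$ (such a field exists by transverse orientability, and it is automatically of class $C^1$). For a leaf $F\in\mathcal F$ and $x\in F$, let $$H_F(x)=\operatorname{tr}\bigl(T_xF\to T_xF,\; v\mapsto(\nabla_v\eta)^{\top}\bigr)$$ be the (unnormalised) mean curvature of $F$ at $x$ with respect to $\eta$, where $\nabla$ is the Levi-Civita connection of $M$ and $\top$ denotes the orthogonal projection onto $T_xF$. Let $$\lambda^{*}(\Omega)=\inf\left\{\frac{\int_\Omega|\nabla f|^2}{\int_\Omega f^2}\;:\; f\in H^1_0(\Omega)\setminus\{0\}\right\}$$ be the fundamental tone of $\Omega$, where $H_0^1(\Omega)$ is the completion of $C_0^\infty(\Omega)$ with respect to the norm $\|\varphi\|_\Omega^2=\int_\Omega\varphi^2+\int_\Omega|\nabla\varphi|^2$ and the integrals are with respect to the Riemannian volume.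 Then $$2\sqrt{\lambda^{*}(\Omega)}\;\ge\;\inf_{F\in\mathcal F}\,\inf_{x\in F}|H_F(x)|.$$ -/

import Mathlib

open Set Filter Topology MeasureTheory Manifold Bundle
open scoped ENNReal ContDiff

noncomputable section

namespace RiemFol

section Riemannian

variable {n : ℕ} {M : Type*} [TopologicalSpace M] [ChartedSpace (EuclideanSpace ℝ (Fin n)) M]
  [IsManifold (𝓡 n) ∞ M]

instance finiteDimensional_tangentSpace (x : M) : FiniteDimensional ℝ (TangentSpace (𝓡 n) x) :=
  inferInstanceAs (FiniteDimensional ℝ (EuclideanSpace ℝ (Fin n)))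

variable [RiemannianBundle (fun x : M => TangentSpace (𝓡 n) x)]

/-- The coordinate vector field `∂ᵢ` of the preferred chart at `x₀`, as a tangent vector at the
point with coordinates `u`. -/
def coordVec (x₀ : M) (u : EuclideanSpace ℝ (Fin n)) (i : Fin n) :
    TangentSpace (𝓡 n) ((extChartAt (𝓡 n) x₀).symm u) :=
  mfderiv 𝓘(ℝ, EuclideanSpace ℝ (Fin n)) (𝓡 n) (extChartAt (𝓡 n) x₀).symm u
    (EuclideanSpace.single i (1 : ℝ))

/-- The metric coefficients `g_{ij} = ⟨∂ᵢ, ∂ⱼ⟩` in the preferred chart at `x₀`, as functions of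
the coordinates `u`. -/
def metricCoeff (x₀ : M) (u : EuclideanSpace ℝ (Fin n)) : Matrix (Fin n) (Fin n) ℝ :=
  Matrix.of fun i j => inner ℝ (coordVec x₀ u i) (coordVec x₀ u j)

/-- `∂ₖ g_{ij}` in the preferred chart at `x₀`. -/
def metricCoeffDeriv (x₀ : M) (u : EuclideanSpace ℝ (Fin n)) (k i j : Fin n) : ℝ :=
  fderiv ℝ (fun u' => metricCoeff x₀ u' i j) u (EuclideanSpace.single k (1 : ℝ))

/-- The Christoffel symbols
`Γᵏᵢⱼ = ½ ∑ₗ gᵏˡ (∂ᵢ gⱼₗ + ∂ⱼ gᵢₗ - ∂ₗ gᵢⱼ)` of the Levi-Civita connection, in the preferred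
chart at `x₀`. -/
def christoffel (x₀ : M) (u : EuclideanSpace ℝ (Fin n)) (k i j : Fin n) : ℝ :=
  (1 / 2 : ℝ) * ∑ l, (metricCoeff x₀ u)⁻¹ k l *
    (metricCoeffDeriv x₀ u i j l + metricCoeffDeriv x₀ u j i l - metricCoeffDeriv x₀ u l i j)

/-- The coordinate expression `(X¹, …, Xⁿ)` of a vector field in the preferred chart at `x₀`. -/
def coordField (X : Π x : M, TangentSpace (𝓡 n) x) (x₀ : M) (u : EuclideanSpace ℝ (Fin n)) :
    EuclideanSpace ℝ (Fin n) :=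
  mfderiv (𝓡 n) 𝓘(ℝ, EuclideanSpace ℝ (Fin n)) (extChartAt (𝓡 n) x₀)
    ((extChartAt (𝓡 n) x₀).symm u) (X ((extChartAt (𝓡 n) x₀).symm u))

/-- The covariant derivative of a vector field in the preferred chart at `x₀`: the linear map
`a ↦ (∂ₐ Xᵏ + ∑ᵢⱼ Γᵏᵢⱼ aⁱ Xʲ)ₖ`. -/
def coordCovDeriv (X : Π x : M, TangentSpace (𝓡 n) x) (x₀ : M) (u : EuclideanSpace ℝ (Fin n)) :
    EuclideanSpace ℝ (Fin n) →L[ℝ] EuclideanSpace ℝ (Fin n) :=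
  fderiv ℝ (coordField X x₀) u + Matrix.toEuclideanCLM (𝕜 := ℝ)
    (Matrix.of fun k i => ∑ j, christoffel x₀ u k i j * coordField X x₀ u j)

/-- The covariant derivative `v ↦ ∇ᵥ X` of a vector field `X` at the point `x`, for the
Levi-Civita connection, computed in the preferred chart at `x`. -/
def covDeriv (X : Π x : M, TangentSpace (𝓡 n) x) (x : M) :
    TangentSpace (𝓡 n) x →L[ℝ] TangentSpace (𝓡 n) x :=
  let φ : TangentSpace (𝓡 n) x →L[ℝ] EuclideanSpace ℝ (Fin n) :=
    mfderiv (𝓡 n) 𝓘(ℝ, EuclideanSpace ℝ (Fin n)) (extChartAt (𝓡 n) x) x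
  φ.inverse ∘L coordCovDeriv X x (extChartAt (𝓡 n) x x) ∘L φ

/-- The gradient of a function: the vector field dual to its differential. -/
def grad (f : M → ℝ) (x : M) : TangentSpace (𝓡 n) x :=
  haveI : CompleteSpace (TangentSpace (𝓡 n) x) := FiniteDimensional.complete ℝ _
  (InnerProductSpace.toDual ℝ (TangentSpace (𝓡 n) x)).symm (mfderiv (𝓡 n) 𝓘(ℝ, ℝ) f x)

/-- The Riemannian volume of the domain of the preferred chart at `x₀`, as a measure on `M`:
`√(det g) du¹ ⋯ duⁿ` carried over to `M` by the chart. -/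
def chartVolume [MeasurableSpace M] (x₀ : M) : Measure M :=
  Measure.map (extChartAt (𝓡 n) x₀).symm
    ((volume.restrict (extChartAt (𝓡 n) x₀).target).withDensity
      fun u => ENNReal.ofReal (Real.sqrt (metricCoeff x₀ u).det))

variable (n M) in
/-- The Riemannian volume measure. The measures `chartVolume x₀` agree on overlaps of charts, and
on a second countable manifold their least upper bound is the measure which restricts to
`√(det g) du¹ ⋯ duⁿ` in every chart. -/
def riemannianVolume [MeasurableSpace M] : Measure M :=
  ⨆ x₀ : M, chartVolume (n := n) x₀

variable (n) in
/-- `C₀^∞(Ω)`: smooth functions with compact support contained in `Ω`. -/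
def IsTestFunction (Ω : Set M) (φ : M → ℝ) : Prop :=
  ContMDiff (𝓡 n) 𝓘(ℝ, ℝ) ∞ φ ∧ HasCompactSupport φ ∧ tsupport φ ⊆ Ω

variable (n) in
/-- A measurable vector field on `Ω`: its coordinate expression in each preferred chart is
a.e. measurable. -/
def IsMeasurableField [MeasurableSpace M] (Ω : Set M) (G : Π x : M, TangentSpace (𝓡 n) x) : Prop :=
  ∀ x₀ : M, AEStronglyMeasurable
    (fun x => (mfderiv (𝓡 n) 𝓘(ℝ, EuclideanSpace ℝ (Fin n)) (extChartAt (𝓡 n) x₀) x (G x) :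
      EuclideanSpace ℝ (Fin n)))
    ((riemannianVolume n M).restrict (Ω ∩ (extChartAt (𝓡 n) x₀).source))

/-- `f ∈ H₀¹(Ω)` with (weak) gradient `G`: the pair `(f, G)` is a limit in `L²(Ω)` of pairs
`(φ, ∇φ)` with `φ ∈ C₀^∞(Ω)`. This is the completion of `C₀^∞(Ω)` for the norm
`(∫ φ² + ∫ |∇φ|²)^{1/2}`, realised inside `L²`. -/
def IsH01 [MeasurableSpace M] (Ω : Set M) (f : M → ℝ) (G : Π x : M, TangentSpace (𝓡 n) x) : Prop :=
  AEStronglyMeasurable f ((riemannianVolume n M).restrict Ω) ∧ IsMeasurableField n Ω G ∧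
  ∃ φ : ℕ → M → ℝ, (∀ k, IsTestFunction n Ω (φ k)) ∧
    Tendsto (fun k => ∫⁻ x in Ω, ‖φ k x - f x‖ₑ ^ 2 ∂(riemannianVolume n M)) atTop (𝓝 0) ∧
    Tendsto (fun k => ∫⁻ x in Ω, ‖grad (φ k) x - G x‖ₑ ^ 2 ∂(riemannianVolume n M)) atTop (𝓝 0)

variable (n) in
/-- The fundamental tone
`λ*(Ω) = inf { ∫_Ω |∇f|² / ∫_Ω f² : f ∈ H₀¹(Ω), f ≠ 0 }`. -/
def fundamentalTone [MeasurableSpace M] (Ω : Set M) : ℝ :=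
  sInf {r : ℝ | ∃ (f : M → ℝ) (G : Π x : M, TangentSpace (𝓡 n) x), IsH01 Ω f G ∧
    ¬ (f =ᵐ[(riemannianVolume n M).restrict Ω] 0) ∧
    r = (∫ x in Ω, ‖G x‖ ^ 2 ∂(riemannianVolume n M)) /
      (∫ x in Ω, f x ^ 2 ∂(riemannianVolume n M))}

end Riemannian

section Foliation

variable {m : ℕ} {M : Type*} [TopologicalSpace M]
  [ChartedSpace (EuclideanSpace ℝ (Fin (m + 1))) M]

variable (m) in
/-- A codimension-one foliation of class `C²` of the set `Ω` in a manifold of dimension `m + 1`,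
given by an atlas of foliated charts `e = (s, t)` with values in rectangles of `ℝᵐ × ℝ`:
the charts are `C²`-diffeomorphisms onto their images, and on overlaps the transverse coordinate
`t'` is locally a function of `t`. -/
structure Foliation (Ω : Set M) where
  /-- the foliated charts -/
  atlas : Set (OpenPartialHomeomorph M (EuclideanSpace ℝ (Fin m) × ℝ))
  iUnion_source : ⋃ e ∈ atlas, e.source = Ω
  target_eq : ∀ e ∈ atlas, ∃ (A : Set (EuclideanSpace ℝ (Fin m))) (B : Set ℝ),
    IsPreconnected A ∧ IsPreconnected B ∧ e.target = A ×ˢ B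
  contMDiffOn : ∀ e ∈ atlas,
    ContMDiffOn (𝓡 (m + 1)) 𝓘(ℝ, EuclideanSpace ℝ (Fin m) × ℝ) 2 e e.source
  contMDiffOn_symm : ∀ e ∈ atlas,
    ContMDiffOn 𝓘(ℝ, EuclideanSpace ℝ (Fin m) × ℝ) (𝓡 (m + 1)) 2 e.symm e.target
  compatible : ∀ e ∈ atlas, ∀ e' ∈ atlas, ∀ x ∈ e.source ∩ e'.source,
    ∃ h : ℝ → ℝ, ∀ᶠ z in 𝓝 x, (e' z).2 = h (e z).2

namespace Foliation

variable {Ω : Set M} (𝓕 : Foliation m Ω)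

/-- Two points lie in a common plaque `{t = const}` of some foliated chart. -/
def SamePlaque (x y : M) : Prop :=
  ∃ e ∈ 𝓕.atlas, x ∈ e.source ∧ y ∈ e.source ∧ (e x).2 = (e y).2

/-- The leaf through `x`: all points that can be joined to `x` by a finite chain of plaques. -/
def leaf (x : M) : Set M := {y | Relation.ReflTransGen 𝓕.SamePlaque x y}

/-- The set of leaves of the foliation. -/
def leaves : Set (Set M) := 𝓕.leaf '' Ω

/-- The tangent space `T_x F ⊆ T_x M` at `x` of the leaf `F` through `x`: the kernel of the
differential of the transverse coordinate `t` (of any foliated chart around `x`). -/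
def tangentSpace (x : M) : Submodule ℝ (TangentSpace (𝓡 (m + 1)) x) :=
  ⨅ e ∈ {e ∈ 𝓕.atlas | x ∈ e.source},
    (mfderiv (𝓡 (m + 1)) 𝓘(ℝ, ℝ) (fun z => (e z).2) x).ker

variable [IsManifold (𝓡 (m + 1)) ∞ M]
  [RiemannianBundle (fun x : M => TangentSpace (𝓡 (m + 1)) x)]

/-- `η` is a (continuous) unit vector field on `Ω` normal to the leaves; the foliation is
transversely orientable when such a field exists. -/
structure IsUnitNormal (η : Π x : M, TangentSpace (𝓡 (m + 1)) x) : Prop where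
  continuousOn :
    ContinuousOn (fun x => (⟨x, η x⟩ : TangentBundle (𝓡 (m + 1)) M)) Ω
  norm_eq_one : ∀ x ∈ Ω, ‖η x‖ = 1
  normal : ∀ x ∈ Ω, ∀ v ∈ 𝓕.tangentSpace x, inner ℝ (η x) v = 0

/-- The endomorphism `v ↦ (∇ᵥ η)ᵀ` of the tangent space at `x` of the leaf through `x`
(the shape operator up to sign). -/
def weingarten (η : Π x : M, TangentSpace (𝓡 (m + 1)) x) (x : M) :
    𝓕.tangentSpace x →ₗ[ℝ] 𝓕.tangentSpace x :=
  (𝓕.tangentSpace x).orthogonalProjectionOnto.toLinearMap ∘ₗ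
    (covDeriv η x).toLinearMap ∘ₗ (𝓕.tangentSpace x).subtype

/-- The (unnormalised) mean curvature `H_F(x)` of the leaf `F` through `x`, with respect to the
unit normal field `η`: the trace over `T_x F` of `v ↦ (∇ᵥ η)ᵀ`, i.e. the sum of the principal
curvatures. Changing the sign of `η` changes the sign of `H_F`. -/
def meanCurvature (η : Π x : M, TangentSpace (𝓡 (m + 1)) x) (x : M) : ℝ :=
  LinearMap.trace ℝ (𝓕.tangentSpace x) (𝓕.weingarten η x)

end Foliation

end Foliation

end RiemFol

end

/-!
The mean curvature of the leaves is the divergence of the unit normal field `η`: the trace of `∇η`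
splits into the trace of its compression to the tangent space of the leaf, which is `H`, and
`⟨∇_η η, η⟩ = ½ η(|η|²) = 0`. If `c = inf |H| > 0`, then `H`, being continuous on the connected set
`Ω`, has a constant sign `ε`. For a test function `φ`, integrating the divergence of `ε φ² η` gives

  `0 = ∫ (ε H φ² + 2 ε φ ⟨∇φ, η⟩) ≥ ∫ (c φ² - 2 |φ| |∇φ|) ≥ ∫ (c/2 φ² - 2/c |∇φ|²)`,

so that `(c/2)² ∫ φ² ≤ ∫ |∇φ|²` (`IsUnitNormal.sq_mul_integral_le`). This passes to limits in
`H₀¹(Ω)` (`le_div_of_isH01`), and `H₀¹(Ω)` contains a nonzero function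
(`exists_isH01_ne_zero`); hence `λ*(Ω) ≥ (c/2)²`.

Three facts carry the argument.

* `η` is of class `C¹` (`IsUnitNormal.contDiffAt_coordField`). Locally `η = ± ∇t / |∇t|` for the
  `C²` transverse coordinate `t` of a foliated chart. In coordinates `ηⁱ = s⁻¹ wⁱ` with
  `s = dt(η)` and `w = ∇t`; here `s² = |∇t|²` is `C¹` and the sign of the nowhere vanishing
  continuous function `s` is locally constant.
* The divergence `∂ᵢ Yⁱ + ½ Y(log det g)` does not depend on the chart
  (`coordDiv_eq_of_transition`), by Jacobi's formula and the symmetry of the second derivative of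
  the transition map. The connection is defined at each point by the preferred chart there, so this
  is what makes `H` the divergence of `η` in one fixed chart
  (`IsUnitNormal.meanCurvature_eq_coordDiv`).
* The Riemannian volume restricts to `√(det g) du` in each chart
  (`riemannianVolume_restrict_source`), by the change of variables formula. The divergence theorem
  for compactly supported fields (`IsUnitNormal.integral_divNormal`) therefore reduces to that of
  Euclidean space by a partition of unity.
-/

noncomputable section

namespace RiemFol

/-! ### Linear algebra -/

section Linear

variable {V : Type*} [NormedAddCommGroup V] [InnerProductSpace ℝ V] [FiniteDimensional ℝ V]

/-- The trace of `T` splits into the trace of its compression to a hyperplane `W` and the diagonal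
entry of `T` in the direction of the unit normal `N`. -/
lemma trace_eq_trace_compress_add_inner (W : Submodule ℝ V) (N : V) (hN : ‖N‖ = 1)
    (ℓ : V →ₗ[ℝ] ℝ) (hW : W = LinearMap.ker ℓ) (hperp : ∀ v ∈ W, inner ℝ N v = 0)
    (T : V →ₗ[ℝ] V) :
    LinearMap.trace ℝ V T =
      LinearMap.trace ℝ W (W.orthogonalProjectionOnto.toLinearMap ∘ₗ T ∘ₗ W.subtype)
        + inner ℝ N (T N) := by
  have hNN : inner ℝ N N = (1 : ℝ) := by rw [real_inner_self_eq_norm_sq, hN]; norm_num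
  have hℓN : ℓ N ≠ 0 := by
    intro h
    have := hperp N (by rw [hW]; exact h)
    rw [hNN] at this; norm_num at this
  have hdec : ∀ v, v - (inner ℝ N v) • N ∈ W := by
    intro v
    have h1 : v - (ℓ v / ℓ N) • N ∈ W := by
      rw [hW, LinearMap.mem_ker, map_sub, map_smul, smul_eq_mul]; field_simp; ring
    have h2 := hperp _ h1
    rw [inner_sub_right, inner_smul_right, hNN] at h2
    have : inner ℝ N v = ℓ v / ℓ N := by linarith
    rwa [this]
  have hproj : ∀ v, W.starProjection v = v - (inner ℝ N v) • N := by
    intro v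
    refine Submodule.eq_starProjection_of_mem_of_inner_eq_zero (hdec v) ?_
    intro w hw
    simp [inner_smul_left, hperp w hw]
  have hT : T = W.subtype ∘ₗ (W.orthogonalProjectionOnto.toLinearMap ∘ₗ T)
      + ((innerₛₗ ℝ N) ∘ₗ T).smulRight N := by
    ext v
    have := hproj (T v)
    rw [Submodule.starProjection_apply] at this
    simp [this]
  conv_lhs => rw [hT]
  rw [map_add, LinearMap.trace_comp_comm', LinearMap.trace_smulRight]
  rfl

end Linear

/-! ### Derivatives of determinants -/

section Jacobi

variable {E : Type*} [NormedAddCommGroup E] [NormedSpace ℝ E] {ι : Type*}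
  [Fintype ι] [DecidableEq ι]

/-- Jacobi's formula for the derivative of a determinant. -/
lemma hasFDerivAt_det {A : E → Matrix ι ι ℝ} {A' : ι → ι → E →L[ℝ] ℝ} {u : E}
    (h : ∀ i j, HasFDerivAt (fun v => A v i j) (A' i j) u) (hA : (A u).det ≠ 0) :
    HasFDerivAt (fun v => (A v).det)
      ((A u).det • ∑ i, ∑ j, (A u)⁻¹ j i • A' i j) u := by
  let f : ContinuousMultilinearMap ℝ (fun _ : ι => ι → ℝ) ℝ :=
    ⟨(Matrix.detRowAlternating (n := ι) (R := ℝ)).toMultilinearMap,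
      (continuous_id (X := Matrix ι ι ℝ)).matrix_det⟩
  let a : E → ι → ι → ℝ := fun v i j => A v i j
  have h1 : HasFDerivAt a
      (ContinuousLinearMap.pi fun i => ContinuousLinearMap.pi fun j => A' i j) u := by
    rw [hasFDerivAt_pi]
    intro i
    rw [hasFDerivAt_pi]
    exact fun j => h i j
  have h2 : HasFDerivAt (fun v => (A v).det) _ u := (f.hasFDerivAt (a u)).comp u h1
  refine h2.congr_fderiv ?_
  ext v
  -- the expansion of the determinant along the row `i`
  have key : ∀ i (b : ι → ℝ), Matrix.det ((A u).updateRow i b)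
      = ∑ j, (A u).det * (A u)⁻¹ j i * b j := by
    intro i b
    rw [← Matrix.cramer_transpose_apply, Matrix.cramer_eq_adjugate_mulVec]
    simp only [Matrix.mulVec, dotProduct, ← Matrix.adjugate_transpose, Matrix.transpose_apply]
    refine Finset.sum_congr rfl fun j _ => ?_
    rw [Matrix.inv_def, Matrix.smul_apply, Ring.inverse_eq_inv', smul_eq_mul]
    field_simp
  have hrow : ∀ i, f (Function.update (a u) i ((ContinuousLinearMap.pi fun i =>
      ContinuousLinearMap.pi fun j => A' i j) v i)) = ∑ j, (A u).det * (A u)⁻¹ j i * A' i j v :=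
    fun i => key i _
  rw [ContinuousLinearMap.comp_apply, ContinuousMultilinearMap.linearDeriv_apply,
    Finset.sum_congr rfl fun i _ => hrow i]
  simp [Finset.mul_sum, mul_assoc]

end Jacobi

/-! ### The divergence in coordinates -/

section Euclidean

variable {n : ℕ}

local notation "E" => EuclideanSpace ℝ (Fin n)

lemma trace_eq_sum (T : E →L[ℝ] E) :
    LinearMap.trace ℝ E T.toLinearMap = ∑ i, T (EuclideanSpace.single i 1) i := by
  rw [LinearMap.trace_eq_matrix_trace ℝ (EuclideanSpace.basisFun (Fin n) ℝ).toBasis]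
  simp [Matrix.trace, LinearMap.toMatrix_apply]

lemma sum_smul_single (a : E) : ∑ i, a i • EuclideanSpace.single i (1 : ℝ) = a := by
  simpa using (EuclideanSpace.basisFun (Fin n) ℝ).sum_repr a

/-- Jacobi's formula for the determinant of a family of endomorphisms. -/
lemma hasFDerivAt_clm_det {L : E → E →L[ℝ] E} {L' : E →L[ℝ] E →L[ℝ] E} {u : E}
    (h : HasFDerivAt L L' u) {K : E →L[ℝ] E} (hK : K ∘L L u = .id ℝ E) :
    ∃ J' : E →L[ℝ] ℝ, HasFDerivAt (fun v => (L v).det) J' u ∧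
      ∀ v, J' v = (L u).det * LinearMap.trace ℝ E (K ∘L L' v).toLinearMap := by
  set b := (EuclideanSpace.basisFun (Fin n) ℝ).toBasis
  set A : E → Matrix (Fin n) (Fin n) ℝ := fun v => LinearMap.toMatrix b b (L v).toLinearMap
  have hdet : ∀ v, (A v).det = (L v).det := fun v => LinearMap.det_toMatrix b _
  have hKA : LinearMap.toMatrix b b K.toLinearMap * A u = 1 := by
    rw [← LinearMap.toMatrix_comp b b b, ← LinearMap.toMatrix_id b]
    congr 1
    exact congrArg ContinuousLinearMap.toLinearMap hK
  have hA0 : (A u).det ≠ 0 := by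
    intro h0
    have := congrArg Matrix.det hKA
    simp [h0] at this
  have hinv : (A u)⁻¹ = LinearMap.toMatrix b b K.toLinearMap := Matrix.inv_eq_left_inv hKA
  let A' : Fin n → Fin n → E →L[ℝ] ℝ := fun i j =>
    (EuclideanSpace.proj i ∘L ContinuousLinearMap.apply ℝ E (EuclideanSpace.single j (1 : ℝ))) ∘L L'
  have hA' : ∀ i j, HasFDerivAt (fun v => A v i j) (A' i j) u := by
    intro i j
    have := ((EuclideanSpace.proj (𝕜 := ℝ) i ∘L ContinuousLinearMap.apply ℝ E
      (EuclideanSpace.single j (1 : ℝ))).hasFDerivAt (x := L u)).comp u h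
    refine this.congr_of_eventuallyEq (Eventually.of_forall fun v => ?_)
    simp [A, b, LinearMap.toMatrix_apply]
  have hd := hasFDerivAt_det hA' hA0
  simp only [hdet] at hd
  refine ⟨_, hd, fun v => ?_⟩
  rw [hinv, LinearMap.trace_eq_matrix_trace ℝ b, ContinuousLinearMap.toLinearMap_comp,
    LinearMap.toMatrix_comp b b b, Matrix.trace_mul_comm]
  simp [Matrix.trace, Matrix.mul_apply, A', b, LinearMap.toMatrix_apply, mul_comm]

/-- The coordinate expression `∂ᵢ Yⁱ + ½ Y(log d)` of the divergence of a vector field `Y`, where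
`d` is the determinant of the metric. -/
def coordDiv (Y : E → E) (d : E → ℝ) (u : E) : ℝ :=
  LinearMap.trace ℝ E (fderiv ℝ Y u).toLinearMap + fderiv ℝ d u (Y u) / (2 * d u)

/-- Invariance of the divergence under a change of coordinates. -/
lemma coordDiv_eq_of_transition {τ : E → E} {u : E} (hτ : ContDiffAt ℝ 2 τ u)
    {K : E →L[ℝ] E} (hK : K ∘L fderiv ℝ τ u = .id ℝ E)
    {Y₀ Y₁ : E → E} {d₀ d₁ : E → ℝ} (hY₀ : DifferentiableAt ℝ Y₀ u)
    (hY₁ : DifferentiableAt ℝ Y₁ (τ u)) (hd₁ : DifferentiableAt ℝ d₁ (τ u)) (hd : d₁ (τ u) ≠ 0)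
    (hY : ∀ᶠ v in 𝓝 u, Y₁ (τ v) = fderiv ℝ τ v (Y₀ v))
    (hdd : ∀ᶠ v in 𝓝 u, d₀ v = (fderiv ℝ τ v).det ^ 2 * d₁ (τ v)) :
    coordDiv Y₀ d₀ u = coordDiv Y₁ d₁ (τ u) := by
  have hτd : DifferentiableAt ℝ τ u := hτ.differentiableAt (by norm_num)
  have hL : HasFDerivAt (fderiv ℝ τ) (fderiv ℝ (fderiv ℝ τ) u) u :=
    ((hτ.fderiv_right (m := 1) (by norm_num)).differentiableAt (by norm_num)).hasFDerivAt
  obtain ⟨J', hJ', hJ'v⟩ := hasFDerivAt_clm_det hL hK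
  have hsymm : IsSymmSndFDerivAt ℝ τ u := hτ.isSymmSndFDerivAt (by simp)
  set L := fderiv ℝ τ u with hLdef
  set L' := fderiv ℝ (fderiv ℝ τ) u
  have hJ0 : L.det ≠ 0 := by
    intro h0
    have := congrArg ContinuousLinearMap.det hK
    rw [ContinuousLinearMap.det, ContinuousLinearMap.toLinearMap_comp, LinearMap.det_comp] at this
    rw [ContinuousLinearMap.det] at h0
    simp [h0, ContinuousLinearMap.det] at this
  have hYu := hY.self_of_nhds
  -- differentiate the transformation law of the components
  have h1 : HasFDerivAt (fun v => Y₁ (τ v)) (fderiv ℝ Y₁ (τ u) ∘L L) u :=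
    hY₁.hasFDerivAt.comp u hτd.hasFDerivAt
  have h2 : HasFDerivAt (fun v => fderiv ℝ τ v (Y₀ v)) (L ∘L fderiv ℝ Y₀ u + L'.flip (Y₀ u)) u :=
    hL.clm_apply hY₀.hasFDerivAt
  have h12 : fderiv ℝ Y₁ (τ u) ∘L L = L ∘L fderiv ℝ Y₀ u + L'.flip (Y₀ u) :=
    h1.unique (h2.congr_of_eventuallyEq hY)
  have hflip : L'.flip (Y₀ u) = L' (Y₀ u) := by
    ext1 w
    exact hsymm w (Y₀ u)
  have hLK : L ∘L K = .id ℝ E := by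
    have := (LinearMap.comp_eq_id_comm (f := K.toLinearMap) (g := L.toLinearMap)).1
      (congrArg ContinuousLinearMap.toLinearMap hK)
    ext1 w
    exact LinearMap.congr_fun this w
  have h3 := congrArg (fun T => LinearMap.trace ℝ E (K ∘L T).toLinearMap) h12
  simp only [ContinuousLinearMap.comp_add, ContinuousLinearMap.toLinearMap_add, map_add] at h3
  rw [← ContinuousLinearMap.comp_assoc K L, hK, ContinuousLinearMap.id_comp, hflip,
    ContinuousLinearMap.toLinearMap_comp, LinearMap.trace_comp_comm',
    ← ContinuousLinearMap.toLinearMap_comp, ContinuousLinearMap.comp_assoc, hLK,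
    ContinuousLinearMap.comp_id] at h3
  -- differentiate the transformation law of the determinant of the metric
  have hd₀ : HasFDerivAt d₀ _ u :=
    ((hJ'.pow 2).mul (hd₁.hasFDerivAt.comp u hτd.hasFDerivAt)).congr_of_eventuallyEq hdd
  rw [coordDiv, coordDiv, hd₀.fderiv, hdd.self_of_nhds, hYu, h3]
  simp only [add_apply, smul_apply,
    ContinuousLinearMap.comp_apply, smul_eq_mul, hJ'v]
  simp only [← hLdef, Function.comp_apply]
  field_simp
  ring

/-- The divergence theorem for compactly supported vector fields. -/
lemma integral_trace_fderiv_eq_zero {w : E → E} (hw : ContDiff ℝ 1 w) (hc : HasCompactSupport w) :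
    Integrable (fun u => LinearMap.trace ℝ E (fderiv ℝ w u).toLinearMap) ∧
      ∫ u, LinearMap.trace ℝ E (fderiv ℝ w u).toLinearMap = 0 := by
  have hcomp : ∀ i u, fderiv ℝ w u (EuclideanSpace.single i 1) i
      = fderiv ℝ (fun v => w v i) u (EuclideanSpace.single i 1) := by
    intro i u
    have := ((EuclideanSpace.proj (𝕜 := ℝ) i).hasFDerivAt (x := w u)).comp u
      (hw.differentiable (by norm_num) u).hasFDerivAt
    have h2 := this.fderiv
    change _ = fderiv ℝ (EuclideanSpace.proj (𝕜 := ℝ) i ∘ w) u _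
    rw [h2]; rfl
  have hwi : ∀ i, ContDiff ℝ 1 (fun v => w v i) := fun i =>
    (EuclideanSpace.proj (𝕜 := ℝ) i : E →L[ℝ] ℝ).contDiff.comp hw
  have hci : ∀ i, HasCompactSupport (fun v => w v i) := fun i =>
    hc.comp_left (g := fun x : E => x i) rfl
  have hint : ∀ i, Integrable
      (fun u => fderiv ℝ (fun v => w v i) u (EuclideanSpace.single i (1 : ℝ))) := by
    intro i
    refine Continuous.integrable_of_hasCompactSupport ?_ ?_
    · exact ((hwi i).continuous_fderiv (by norm_num)).clm_apply continuous_const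
    · exact (hci i).fderiv_apply ℝ _
  simp_rw [trace_eq_sum, hcomp]
  refine ⟨integrable_finsetSum _ fun i _ => hint i, ?_⟩
  rw [integral_finsetSum _ fun i _ => hint i]
  refine Finset.sum_eq_zero fun i _ => ?_
  have := integral_mul_fderiv_eq_neg_fderiv_mul_of_integrable (μ := (volume : Measure E))
    (f := fun _ => (1 : ℝ)) (g := fun v => w v i) (v := EuclideanSpace.single i (1 : ℝ))
    (by simp) (by simpa using hint i)
    (by simpa using (hwi i).continuous.integrable_of_hasCompactSupport (hci i))
    (fun _ _ => by fun_prop) (fun x _ => (hwi i).differentiable (by norm_num) x)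
  simpa using this

/-- The divergence theorem in coordinates, for the vector field `h Y` and the volume density `√d`:
here `h` vanishes outside a compact subset of the domain `U` of the coordinates. -/
lemma integral_mul_coordDiv_add_fderiv_eq_zero {U K : Set E} (hU : IsOpen U) (hK : IsCompact K)
    (hKU : K ⊆ U) {h d : E → ℝ} {Y : E → E} (hh : ContDiffOn ℝ 1 h U) (hd : ContDiffOn ℝ 1 d U)
    (hY : ContDiffOn ℝ 1 Y U) (hpos : ∀ u ∈ U, 0 < d u) (hzero : ∀ u ∈ U, u ∉ K → h u = 0) :
    ∃ F : E → ℝ, Continuous F ∧ HasCompactSupport F ∧ ∫ u, F u = 0 ∧ (∀ u ∉ U, F u = 0) ∧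
      ∀ u ∈ U, F u = (h u * coordDiv Y d u + fderiv ℝ h u (Y u)) * √(d u) := by
  classical
  -- the components of the density `h √d Y`, extended by zero, whose Euclidean divergence is `F`
  set w : E → E := U.indicator fun u => (h u * √(d u)) • Y u with hw
  have hsmooth : ∀ u ∈ U, w =ᶠ[𝓝 u] fun u => (h u * √(d u)) • Y u := fun u hu =>
    (hU.eventually_mem hu).mono fun v hv => indicator_of_mem hv _
  have hvanish : ∀ u ∉ K, w =ᶠ[𝓝 u] fun _ => 0 := by
    intro u hu
    filter_upwards [hK.isClosed.isOpen_compl.eventually_mem hu] with v hv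
    by_cases hvU : v ∈ U
    · simp [hw, hvU, hzero v hvU hv]
    · simp [hw, hvU]
  have hwC : ContDiff ℝ 1 w := by
    rw [contDiff_iff_contDiffAt]
    intro u
    by_cases hu : u ∈ U
    · have hn := hU.mem_nhds hu
      exact (((hh.contDiffAt hn).mul ((hd.contDiffAt hn).sqrt (hpos u hu).ne')).smul
        (hY.contDiffAt hn)).congr_of_eventuallyEq (hsmooth u hu)
    · exact contDiffAt_const.congr_of_eventuallyEq (hvanish u fun h => hu (hKU h))
  have hwc : HasCompactSupport w :=
    HasCompactSupport.intro hK fun u hu => (hvanish u hu).self_of_nhds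
  refine ⟨fun u => LinearMap.trace ℝ E (fderiv ℝ w u).toLinearMap, ?_, ?_,
    (integral_trace_fderiv_eq_zero hwC hwc).2, ?_, ?_⟩
  · simp_rw [trace_eq_sum]
    refine continuous_finsetSum _ fun i _ => ?_
    exact (EuclideanSpace.proj (𝕜 := ℝ) i).continuous.comp
      ((hwC.continuous_fderiv (by norm_num)).clm_apply continuous_const)
  · refine HasCompactSupport.intro hK fun u hu => ?_
    have : fderiv ℝ w u = fderiv ℝ (fun _ => (0 : E)) u := (hvanish u hu).fderiv_eq
    simp [this]
  · intro u hu
    have : fderiv ℝ w u = fderiv ℝ (fun _ => (0 : E)) u :=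
      (hvanish u fun h => hu (hKU h)).fderiv_eq
    simp [this]
  · intro u hu
    have hn := hU.mem_nhds hu
    have hd0 := hpos u hu
    have e1 := ((hh.contDiffAt hn).differentiableAt (by norm_num)).hasFDerivAt
    have e2 := ((hd.contDiffAt hn).differentiableAt (by norm_num)).hasFDerivAt
    have e3 := ((hY.contDiffAt hn).differentiableAt (by norm_num)).hasFDerivAt
    have e4 := ((e1.mul (e2.sqrt hd0.ne')).smul e3).congr_of_eventuallyEq (hsmooth u hu)
    have hs : √(d u) ≠ 0 := (Real.sqrt_pos.2 hd0).ne'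
    have hs2 : d u = √(d u) * √(d u) := (Real.mul_self_sqrt hd0.le).symm
    dsimp only
    rw [e4.fderiv, coordDiv, ContinuousLinearMap.toLinearMap_add, map_add,
      ContinuousLinearMap.toLinearMap_smul, map_smul]
    have hsr : ∀ (f : E →L[ℝ] ℝ) (x : E), (f.smulRight x : E →L[ℝ] E).toLinearMap
      = f.toLinearMap.smulRight x := fun _ _ => rfl
    rw [hsr, LinearMap.trace_smulRight]
    simp only [ContinuousLinearMap.coe_coe, add_apply, smul_apply, smul_eq_mul, Pi.mul_apply]
    have : fderiv ℝ d u (Y u) / (2 * d u) * √(d u) = fderiv ℝ d u (Y u) / (2 * √(d u)) := by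
      rw [div_mul_eq_mul_div, div_eq_div_iff (by positivity) (by positivity)]
      linear_combination (-2 * fderiv ℝ d u (Y u)) * hs2
    linear_combination (-h u) * this

end Euclidean

/-! ### Tangent vectors and the metric in charts -/

section Charts

variable {n : ℕ} {M : Type*} [TopologicalSpace M] [ChartedSpace (EuclideanSpace ℝ (Fin n)) M]

local notation "E" => EuclideanSpace ℝ (Fin n)

/-- The components of a tangent vector at `x` in the preferred chart at `x₀`. -/
def toCoord (x₀ x : M) : TangentSpace (𝓡 n) x →L[ℝ] E :=
  mfderiv (𝓡 n) 𝓘(ℝ, E) (extChartAt (𝓡 n) x₀) x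

/-- The tangent vector with given components in the preferred chart at `x₀`, at the point with
coordinates `u`. -/
def ofCoord (x₀ : M) (u : E) : E →L[ℝ] TangentSpace (𝓡 n) ((extChartAt (𝓡 n) x₀).symm u) :=
  mfderiv 𝓘(ℝ, E) (𝓡 n) (extChartAt (𝓡 n) x₀).symm u

/-- The differential of a function, as a linear form. -/
def diff {F : Type*} [NormedAddCommGroup F] [NormedSpace ℝ F] (f : M → F) (x : M) :
    TangentSpace (𝓡 n) x →L[ℝ] F :=
  mfderiv (𝓡 n) 𝓘(ℝ, F) f x

/-- A transition map between two preferred charts. -/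
def transition (x₀ x₁ : M) : E → E := extChartAt (𝓡 n) x₁ ∘ (extChartAt (𝓡 n) x₀).symm

lemma sum_smul_coordVec (x₀ : M) (u a : E) : ∑ i, a i • coordVec x₀ u i = ofCoord x₀ u a := by
  conv_rhs => rw [← sum_smul_single a]
  rw [map_sum]
  exact Finset.sum_congr rfl fun i _ => (map_smul _ _ _).symm

lemma coordField_eq (X : Π x : M, TangentSpace (𝓡 n) x) (x₀ : M) (u : E) :
    coordField X x₀ u = toCoord x₀ ((extChartAt (𝓡 n) x₀).symm u)
      (X ((extChartAt (𝓡 n) x₀).symm u)) := rfl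

lemma coordField_extChartAt (X : Π x : M, TangentSpace (𝓡 n) x) {x₀ x : M}
    (hx : x ∈ (extChartAt (𝓡 n) x₀).source) :
    coordField X x₀ (extChartAt (𝓡 n) x₀ x) = toCoord x₀ x (X x) := by
  rw [coordField_eq, (extChartAt (𝓡 n) x₀).left_inv hx]

variable [IsManifold (𝓡 n) ∞ M]

lemma toCoord_ofCoord {x₀ : M} {u : E} (hu : u ∈ (extChartAt (𝓡 n) x₀).target) (a : E) :
    toCoord x₀ ((extChartAt (𝓡 n) x₀).symm u) (ofCoord x₀ u a) = a := by
  have := mfderiv_extChartAt_comp_mfderivWithin_extChartAt_symm hu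
  simp only [ModelWithCorners.range_eq_univ, mfderivWithin_univ] at this
  exact DFunLike.congr_fun this a

lemma ofCoord_toCoord {x₀ : M} {u : E} (hu : u ∈ (extChartAt (𝓡 n) x₀).target)
    (v : TangentSpace (𝓡 n) ((extChartAt (𝓡 n) x₀).symm u)) :
    ofCoord x₀ u (toCoord x₀ ((extChartAt (𝓡 n) x₀).symm u) v) = v := by
  have := mfderivWithin_extChartAt_symm_comp_mfderiv_extChartAt hu
  simp only [ModelWithCorners.range_eq_univ, mfderivWithin_univ] at this
  exact DFunLike.congr_fun this v

lemma toCoord_bijective {x₀ x : M} (hx : x ∈ (extChartAt (𝓡 n) x₀).source) :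
    Function.Bijective (toCoord (n := n) x₀ x) := by
  obtain ⟨u, hu, rfl⟩ : ∃ u ∈ (extChartAt (𝓡 n) x₀).target, (extChartAt (𝓡 n) x₀).symm u = x :=
    ⟨_, (extChartAt (𝓡 n) x₀).map_source hx, (extChartAt (𝓡 n) x₀).left_inv hx⟩
  exact ⟨Function.LeftInverse.injective (ofCoord_toCoord hu),
    Function.RightInverse.surjective (toCoord_ofCoord hu)⟩

lemma contDiffAt_transition {x₀ x₁ x : M} (h₀ : x ∈ (extChartAt (𝓡 n) x₀).source)
    (h₁ : x ∈ (extChartAt (𝓡 n) x₁).source) :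
    ContDiffAt ℝ ∞ (transition x₀ x₁) (extChartAt (𝓡 n) x₀ x) := by
  have := contDiffWithinAt_ext_coord_change (I := 𝓡 n) (n := ∞) x₁ x₀
    (y := extChartAt (𝓡 n) x₀ x) (by
      simp only [PartialEquiv.trans_source, PartialEquiv.symm_source, mem_inter_iff, mem_preimage]
      exact ⟨(extChartAt (𝓡 n) x₀).map_source h₀, by rwa [(extChartAt (𝓡 n) x₀).left_inv h₀]⟩)
  rwa [ModelWithCorners.range_eq_univ, contDiffWithinAt_univ] at this

omit [IsManifold (𝓡 n) ∞ M] in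
lemma transition_extChartAt {x₀ x₁ x : M} (h₀ : x ∈ (extChartAt (𝓡 n) x₀).source) :
    transition x₀ x₁ (extChartAt (𝓡 n) x₀ x) = extChartAt (𝓡 n) x₁ x := by
  rw [transition, Function.comp_apply, (extChartAt (𝓡 n) x₀).left_inv h₀]

lemma mdifferentiableAt_extChartAt_of_mem {x₀ x : M} (h₀ : x ∈ (extChartAt (𝓡 n) x₀).source) :
    MDifferentiableAt (𝓡 n) 𝓘(ℝ, E) (extChartAt (𝓡 n) x₀) x :=
  mdifferentiableAt_extChartAt (by rwa [extChartAt_source] at h₀)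

lemma mdifferentiableAt_extChartAt_symm {x₀ : M} {u : E}
    (hu : u ∈ (extChartAt (𝓡 n) x₀).target) :
    MDifferentiableAt 𝓘(ℝ, E) (𝓡 n) (extChartAt (𝓡 n) x₀).symm u := by
  have := mdifferentiableWithinAt_extChartAt_symm hu
  rwa [ModelWithCorners.range_eq_univ, mdifferentiableWithinAt_univ] at this

/-- The derivative of a function in the preferred chart at `x₀`. -/
lemma fderiv_comp_extChartAt_symm {F : Type*} [NormedAddCommGroup F] [NormedSpace ℝ F] {x₀ : M}
    {u : E} (hu : u ∈ (extChartAt (𝓡 n) x₀).target) {f : M → F}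
    (hf : MDifferentiableAt (𝓡 n) 𝓘(ℝ, F) f ((extChartAt (𝓡 n) x₀).symm u)) (a : E) :
    fderiv ℝ (f ∘ (extChartAt (𝓡 n) x₀).symm) u a =
      diff f ((extChartAt (𝓡 n) x₀).symm u) (ofCoord x₀ u a) := by
  rw [← mfderiv_eq_fderiv, mfderiv_comp u hf (mdifferentiableAt_extChartAt_symm hu)]
  rfl

lemma diff_eq_fderiv {F : Type*} [NormedAddCommGroup F]
    [NormedSpace ℝ F] {x₀ x : M} (hx : x ∈ (extChartAt (𝓡 n) x₀).source) {f : M → F}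
    (hf : MDifferentiableAt (𝓡 n) 𝓘(ℝ, F) f x) (v : TangentSpace (𝓡 n) x) :
    diff f x v = fderiv ℝ (f ∘ (extChartAt (𝓡 n) x₀).symm) (extChartAt (𝓡 n) x₀ x)
        (toCoord x₀ x v) := by
  obtain ⟨u, hu, rfl⟩ : ∃ u ∈ (extChartAt (𝓡 n) x₀).target, (extChartAt (𝓡 n) x₀).symm u = x :=
    ⟨_, (extChartAt (𝓡 n) x₀).map_source hx, (extChartAt (𝓡 n) x₀).left_inv hx⟩
  rw [(extChartAt (𝓡 n) x₀).right_inv hu, fderiv_comp_extChartAt_symm hu hf,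
    ofCoord_toCoord hu]

/-- The components of a tangent vector transform by the derivative of the transition map. -/
lemma toCoord_eq_transition {x₀ x₁ x : M} (h₀ : x ∈ (extChartAt (𝓡 n) x₀).source)
    (h₁ : x ∈ (extChartAt (𝓡 n) x₁).source) (v : TangentSpace (𝓡 n) x) :
    toCoord x₁ x v =
      fderiv ℝ (transition x₀ x₁) (extChartAt (𝓡 n) x₀ x) (toCoord x₀ x v) :=
  diff_eq_fderiv h₀ (mdifferentiableAt_extChartAt_of_mem h₁) v

lemma transition_leftInverse {x₀ x₁ x : M} (h₀ : x ∈ (extChartAt (𝓡 n) x₀).source)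
    (h₁ : x ∈ (extChartAt (𝓡 n) x₁).source) :
    fderiv ℝ (transition x₁ x₀) (extChartAt (𝓡 n) x₁ x) ∘L
      fderiv ℝ (transition x₀ x₁) (extChartAt (𝓡 n) x₀ x) = .id ℝ E := by
  ext1 a
  obtain ⟨v, rfl⟩ := (toCoord_bijective h₀).2 a
  rw [ContinuousLinearMap.comp_apply, ← toCoord_eq_transition h₀ h₁, ← toCoord_eq_transition h₁ h₀]
  rfl

/-- The coordinate vector fields are smooth: in the preferred chart they are the local frame of the
tangent bundle induced by the trivialization at `x₀`. -/
lemma contMDiffOn_coordVec (x₀ : M) (i : Fin n) :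
    ContMDiffOn 𝓘(ℝ, E) ((𝓡 n).prod 𝓘(ℝ, E)) ∞
      (fun u => (⟨(extChartAt (𝓡 n) x₀).symm u, coordVec x₀ u i⟩ : TangentBundle (𝓡 n) M))
      (extChartAt (𝓡 n) x₀).target := by
  set b := (EuclideanSpace.basisFun (Fin n) ℝ).toBasis
  have h1 := (trivializationAt E (TangentSpace (𝓡 n)) x₀).contMDiffOn_localFrame_baseSet
    (I := 𝓡 n) ∞ b i
  have h2 := contMDiffOn_extChartAt_symm (I := 𝓡 n) (n := ∞) x₀
  have h3 := h1.comp h2 (fun u hu => by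
    have := (extChartAt (𝓡 n) x₀).map_target hu
    simpa using this)
  refine h3.congr fun u hu => ?_
  have hs : (extChartAt (𝓡 n) x₀).symm u ∈ (chartAt E x₀).source := by
    simpa using (extChartAt (𝓡 n) x₀).map_target hu
  simp only [Function.comp_apply]
  congr 1
  rw [Trivialization.localFrame_apply_of_mem_baseSet _ _ (by simpa using hs)]
  have h4 := TangentBundle.symmL_trivializationAt (I := 𝓡 n) hs
  rw [ModelWithCorners.range_eq_univ, mfderivWithin_univ, (extChartAt (𝓡 n) x₀).right_inv hu] at h4
  have h5 : coordVec x₀ u i = (trivializationAt E (TangentSpace (𝓡 n)) x₀).symmL ℝ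
    ((extChartAt (𝓡 n) x₀).symm u) (EuclideanSpace.single i 1) := by
    rw [h4]; rfl
  have hb : b i = EuclideanSpace.single i 1 := by simp [b]
  rw [h5, Trivialization.basisAt, Module.Basis.map_apply, hb]
  rw [Trivialization.symmL_apply _ (by simpa using hs), Trivialization.linearEquivAt_symm_apply]

variable [RiemannianBundle (fun x : M => TangentSpace (𝓡 n) x)]

lemma inner_eq_sum_metricCoeff {x₀ x : M} (hx : x ∈ (extChartAt (𝓡 n) x₀).source)
    (v w : TangentSpace (𝓡 n) x) :
    inner ℝ v w = ∑ i, ∑ j, metricCoeff x₀ (extChartAt (𝓡 n) x₀ x) i j *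
      toCoord x₀ x v i * toCoord x₀ x w j := by
  obtain ⟨u, hu, rfl⟩ : ∃ u ∈ (extChartAt (𝓡 n) x₀).target, (extChartAt (𝓡 n) x₀).symm u = x :=
    ⟨_, (extChartAt (𝓡 n) x₀).map_source hx, (extChartAt (𝓡 n) x₀).left_inv hx⟩
  rw [(extChartAt (𝓡 n) x₀).right_inv hu]
  conv_lhs => rw [← ofCoord_toCoord hu v, ← ofCoord_toCoord hu w,
    ← sum_smul_coordVec, ← sum_smul_coordVec]
  rw [sum_inner]
  refine Finset.sum_congr rfl fun i _ => ?_
  rw [inner_sum]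
  refine Finset.sum_congr rfl fun j _ => ?_
  rw [inner_smul_left, inner_smul_right, metricCoeff, Matrix.of_apply, conj_trivial]
  ring

omit [IsManifold (𝓡 n) ∞ M] in
lemma metricCoeff_symm (x₀ : M) (u : E) (i j : Fin n) :
    metricCoeff x₀ u i j = metricCoeff x₀ u j i := by
  simp only [metricCoeff, Matrix.of_apply]
  exact real_inner_comm _ _

lemma posDef_metricCoeff {x₀ : M} {u : E} (hu : u ∈ (extChartAt (𝓡 n) x₀).target) :
    (metricCoeff x₀ u).PosDef := by
  rw [Matrix.posDef_iff_dotProduct_mulVec]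
  refine ⟨by ext i j; simpa using metricCoeff_symm x₀ u j i, fun a ha => ?_⟩
  set v := ofCoord x₀ u (WithLp.toLp 2 a) with hv
  have hav : toCoord x₀ ((extChartAt (𝓡 n) x₀).symm u) v = WithLp.toLp 2 a := toCoord_ofCoord hu _
  have hv0 : v ≠ 0 := by
    intro h0
    rw [h0, map_zero] at hav
    exact ha (congrArg WithLp.ofLp hav).symm
  have h1 := inner_eq_sum_metricCoeff ((extChartAt (𝓡 n) x₀).map_target hu) v v
  rw [(extChartAt (𝓡 n) x₀).right_inv hu, hav] at h1
  have h2 : 0 < inner ℝ v v := real_inner_self_pos.2 hv0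
  rw [h1] at h2
  refine lt_of_lt_of_eq h2 ?_
  simp only [dotProduct, Matrix.mulVec, Finset.mul_sum]
  refine Finset.sum_congr rfl fun i _ => Finset.sum_congr rfl fun j _ => ?_
  simp only [Pi.star_apply, star_trivial]; ring

lemma det_metricCoeff_pos {x₀ : M} {u : E} (hu : u ∈ (extChartAt (𝓡 n) x₀).target) :
    0 < (metricCoeff x₀ u).det := (posDef_metricCoeff hu).det_pos

/-- The determinant of the metric is multiplied by the squared Jacobian determinant under a change
of charts, as `g₀ = Bᵀ g₁ B` with the Jacobian matrix `B`. -/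
lemma det_metricCoeff_transition {x₀ x₁ x : M} (h₀ : x ∈ (extChartAt (𝓡 n) x₀).source)
    (h₁ : x ∈ (extChartAt (𝓡 n) x₁).source) :
    (metricCoeff x₀ (extChartAt (𝓡 n) x₀ x)).det =
      (fderiv ℝ (transition x₀ x₁) (extChartAt (𝓡 n) x₀ x)).det ^ 2 *
        (metricCoeff x₁ (extChartAt (𝓡 n) x₁ x)).det := by
  obtain ⟨u, hu, rfl⟩ : ∃ u ∈ (extChartAt (𝓡 n) x₀).target, (extChartAt (𝓡 n) x₀).symm u = x :=
    ⟨_, (extChartAt (𝓡 n) x₀).map_source h₀, (extChartAt (𝓡 n) x₀).left_inv h₀⟩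
  rw [(extChartAt (𝓡 n) x₀).right_inv hu]
  set x := (extChartAt (𝓡 n) x₀).symm u with hx
  set b := (EuclideanSpace.basisFun (Fin n) ℝ).toBasis
  set B := LinearMap.toMatrix b b (fderiv ℝ (transition x₀ x₁) u).toLinearMap with hB
  have hdet : B.det = (fderiv ℝ (transition x₀ x₁) u).det := LinearMap.det_toMatrix b _
  have hB' : ∀ i k, toCoord x₁ x (coordVec x₀ u i) k = B k i := by
    intro i k
    rw [toCoord_eq_transition h₀ h₁, (extChartAt (𝓡 n) x₀).right_inv hu]
    change fderiv ℝ (transition x₀ x₁) u (toCoord x₀ x (ofCoord x₀ u _)) k = _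
    rw [toCoord_ofCoord hu]
    simp [hB, b, LinearMap.toMatrix_apply]
  have hmat : metricCoeff x₀ u = B.transpose * metricCoeff x₁ (extChartAt (𝓡 n) x₁ x) * B := by
    ext i j
    have h1 := inner_eq_sum_metricCoeff h₁ (coordVec x₀ u i) (coordVec x₀ u j)
    have h2 : metricCoeff x₀ u i j = inner ℝ (coordVec x₀ u i) (coordVec x₀ u j) := rfl
    rw [h2, h1]
    simp only [hB', Matrix.mul_apply, Matrix.transpose_apply, Finset.sum_mul]
    rw [Finset.sum_comm]
    refine Finset.sum_congr rfl fun k _ => Finset.sum_congr rfl fun l _ => ?_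
    ring
  rw [hmat, Matrix.det_mul, Matrix.det_mul, Matrix.det_transpose, hdet]
  ring

variable [IsContMDiffRiemannianBundle (𝓡 n) ∞ (EuclideanSpace ℝ (Fin n))
      (fun x : M => TangentSpace (𝓡 n) x)]

lemma contDiffOn_metricCoeff (x₀ : M) (i j : Fin n) :
    ContDiffOn ℝ ∞ (fun u => metricCoeff x₀ u i j) (extChartAt (𝓡 n) x₀).target :=
  ((contMDiffOn_coordVec x₀ i).inner_bundle (contMDiffOn_coordVec x₀ j)).contDiffOn

end Charts

/-! ### The Levi-Civita connection -/

section LeviCivita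

variable {n : ℕ} {M : Type*} [TopologicalSpace M] [ChartedSpace (EuclideanSpace ℝ (Fin n)) M]
  [IsManifold (𝓡 n) ∞ M]
  [RiemannianBundle (fun x : M => TangentSpace (𝓡 n) x)]

local notation "E" => EuclideanSpace ℝ (Fin n)

omit [IsManifold (𝓡 n) ∞ M] in
lemma metricCoeffDeriv_symm (x₀ : M) (u : E) (k i j : Fin n) :
    metricCoeffDeriv x₀ u k i j = metricCoeffDeriv x₀ u k j i := by
  simp only [metricCoeffDeriv, metricCoeff_symm x₀ _ i j]

omit [IsManifold (𝓡 n) ∞ M] in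
lemma metricCoeff_inv_symm (x₀ : M) (u : E) (i j : Fin n) :
    (metricCoeff x₀ u)⁻¹ i j = (metricCoeff x₀ u)⁻¹ j i := by
  have h : (metricCoeff x₀ u).transpose = metricCoeff x₀ u := by
    ext i j; exact metricCoeff_symm x₀ u j i
  conv_lhs => rw [← h, ← Matrix.transpose_nonsing_inv]
  rfl

omit [IsManifold (𝓡 n) ∞ M] in
/-- `∑ₖ Γᵏₖⱼ = ½ ∑ₖₗ gᵏˡ ∂ⱼ gₖₗ`. -/
lemma sum_christoffel (x₀ : M) (u : E) (j : Fin n) :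
    ∑ k, christoffel x₀ u k k j =
      (1 / 2 : ℝ) * ∑ k, ∑ l, (metricCoeff x₀ u)⁻¹ k l * metricCoeffDeriv x₀ u j k l := by
  have h : ∑ k, ∑ l, (metricCoeff x₀ u)⁻¹ k l * metricCoeffDeriv x₀ u k j l
      = ∑ k, ∑ l, (metricCoeff x₀ u)⁻¹ k l * metricCoeffDeriv x₀ u l k j := by
    rw [Finset.sum_comm]
    refine Finset.sum_congr rfl fun k _ => Finset.sum_congr rfl fun l _ => ?_
    rw [metricCoeff_inv_symm, metricCoeffDeriv_symm x₀ u l j k]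
  simp only [christoffel, ← Finset.mul_sum, mul_sub, mul_add, Finset.sum_sub_distrib,
    Finset.sum_add_distrib]
  rw [h]; ring

/-- Lowering the upper index of the Christoffel symbols. -/
lemma sum_metricCoeff_mul_christoffel {x₀ : M} {u : E} (hu : u ∈ (extChartAt (𝓡 n) x₀).target)
    (p q j : Fin n) :
    ∑ i, metricCoeff x₀ u i j * christoffel x₀ u i p q =
      (1 / 2 : ℝ) * (metricCoeffDeriv x₀ u p q j + metricCoeffDeriv x₀ u q p j -
        metricCoeffDeriv x₀ u j p q) := by
  have hinv : metricCoeff x₀ u * (metricCoeff x₀ u)⁻¹ = 1 :=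
    Matrix.mul_nonsing_inv _ (det_metricCoeff_pos hu).ne'.isUnit
  have h1 : ∀ l, ∑ i, metricCoeff x₀ u i j * (metricCoeff x₀ u)⁻¹ i l = if j = l then 1 else 0 := by
    intro l
    rw [← Matrix.one_apply, ← hinv, Matrix.mul_apply]
    exact Finset.sum_congr rfl fun i _ => by rw [metricCoeff_symm]
  calc ∑ i, metricCoeff x₀ u i j * christoffel x₀ u i p q
      = (1 / 2 : ℝ) * ∑ l, (∑ i, metricCoeff x₀ u i j * (metricCoeff x₀ u)⁻¹ i l) *
          (metricCoeffDeriv x₀ u p q l + metricCoeffDeriv x₀ u q p l -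
            metricCoeffDeriv x₀ u l p q) := by
        simp only [christoffel, Finset.mul_sum, Finset.sum_mul]
        rw [Finset.sum_comm]
        refine Finset.sum_congr rfl fun l _ => Finset.sum_congr rfl fun i _ => ?_
        ring
    _ = _ := by simp [h1]

/-- The covariant derivative in coordinates is compatible with the metric:
`2 ⟨∇ₐ X, X⟩ = a(⟨X, X⟩)`. -/
lemma two_mul_sum_metricCoeff_coordCovDeriv {X : Π x : M, TangentSpace (𝓡 n) x} {x₀ : M} {u : E}
    (hu : u ∈ (extChartAt (𝓡 n) x₀).target)
    (hg : ∀ i j, DifferentiableAt ℝ (fun v => metricCoeff x₀ v i j) u)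
    (hX : DifferentiableAt ℝ (coordField X x₀) u) (a : E) :
    2 * ∑ i, ∑ j, metricCoeff x₀ u i j * coordCovDeriv X x₀ u a i * coordField X x₀ u j =
      fderiv ℝ (fun v => ∑ i, ∑ j, metricCoeff x₀ v i j * coordField X x₀ v i *
        coordField X x₀ v j) u a := by
  set Y := coordField X x₀ u with hY
  set D := fderiv ℝ (coordField X x₀) u a with hD
  have hXi : ∀ i, HasFDerivAt (fun v => coordField X x₀ v i)
      (EuclideanSpace.proj i ∘L fderiv ℝ (coordField X x₀) u) u := fun i =>
    (EuclideanSpace.proj (𝕜 := ℝ) i).hasFDerivAt.comp u hX.hasFDerivAt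
  have hdg : ∀ i j, fderiv ℝ (fun v => metricCoeff x₀ v i j) u a
      = ∑ p, a p * metricCoeffDeriv x₀ u p i j := by
    intro i j
    conv_lhs => rw [← sum_smul_single a, map_sum]
    simp [metricCoeffDeriv]
  have hder : HasFDerivAt (fun v => ∑ i, ∑ j, metricCoeff x₀ v i j * coordField X x₀ v i *
        coordField X x₀ v j) _ u :=
    HasFDerivAt.fun_sum fun i _ => HasFDerivAt.fun_sum fun j _ =>
      ((hg i j).hasFDerivAt.mul (hXi i)).mul (hXi j)
  have hR : fderiv ℝ (fun v => ∑ i, ∑ j, metricCoeff x₀ v i j * coordField X x₀ v i *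
        coordField X x₀ v j) u a = ∑ i, ∑ j, ((∑ p, a p * metricCoeffDeriv x₀ u p i j) * Y i * Y j +
        metricCoeff x₀ u i j * D i * Y j + metricCoeff x₀ u i j * Y i * D j) := by
    have hproj : ∀ i (y : E), EuclideanSpace.proj (𝕜 := ℝ) i y = y i := fun _ _ => rfl
    rw [hder.fderiv]
    simp only [sum_apply]
    refine Finset.sum_congr rfl fun i _ => Finset.sum_congr rfl fun j _ => ?_
    rw [← hdg]
    simp only [add_apply, smul_apply, smul_eq_mul, ContinuousLinearMap.comp_apply,
      hproj, Pi.mul_apply, ← hY, ← hD]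
    ring
  have hC : ∀ i, coordCovDeriv X x₀ u a i = D i + ∑ p, ∑ q, christoffel x₀ u i p q * Y q * a p := by
    intro i
    rw [coordCovDeriv, add_apply, PiLp.add_apply, Matrix.ofLp_toEuclideanCLM]
    simp [Matrix.mulVec, dotProduct, Finset.sum_mul, hY, hD]
  have hsw : ∑ i, ∑ j, metricCoeff x₀ u i j * Y i * D j
      = ∑ i, ∑ j, metricCoeff x₀ u i j * D i * Y j := by
    rw [Finset.sum_comm]
    refine Finset.sum_congr rfl fun i _ => Finset.sum_congr rfl fun j _ => ?_
    rw [metricCoeff_symm]; ring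
  have hlow : ∑ i, ∑ j, metricCoeff x₀ u i j * (∑ p, ∑ q, christoffel x₀ u i p q * Y q * a p) * Y j
      = ∑ j, ∑ p, ∑ q, (∑ i, metricCoeff x₀ u i j * christoffel x₀ u i p q) * Y q * a p * Y j := by
    rw [Finset.sum_comm]
    refine Finset.sum_congr rfl fun j _ => ?_
    simp only [Finset.mul_sum, Finset.sum_mul]
    rw [Finset.sum_comm]
    refine Finset.sum_congr rfl fun p _ => ?_
    rw [Finset.sum_comm]
    refine Finset.sum_congr rfl fun q _ => Finset.sum_congr rfl fun i _ => ?_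
    ring
  -- the part of the Christoffel symbol that is antisymmetric in `q`, `j` does not contribute
  have hanti : ∑ j, ∑ p, ∑ q, metricCoeffDeriv x₀ u q p j * Y q * a p * Y j
      = ∑ j, ∑ p, ∑ q, metricCoeffDeriv x₀ u j p q * Y q * a p * Y j := by
    rw [Finset.sum_comm]
    conv_rhs => rw [Finset.sum_comm]
    refine Finset.sum_congr rfl fun p _ => ?_
    rw [Finset.sum_comm]
    refine Finset.sum_congr rfl fun q _ => Finset.sum_congr rfl fun j _ => ?_
    ring
  have hsymm : ∑ j, ∑ p, ∑ q, metricCoeffDeriv x₀ u p q j * Y q * a p * Y j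
      = ∑ i, ∑ j, (∑ p, a p * metricCoeffDeriv x₀ u p i j) * Y i * Y j := by
    rw [Finset.sum_comm' (t' := Finset.univ) (s' := fun _ => Finset.univ) (by simp)]
    simp only [Finset.sum_mul]
    rw [Finset.sum_comm]
    conv_rhs => rw [Finset.sum_comm]
    refine Finset.sum_congr rfl fun j _ => ?_
    rw [Finset.sum_comm]
    refine Finset.sum_congr rfl fun p _ => Finset.sum_congr rfl fun q _ => ?_
    ring
  rw [hR]
  simp only [hC, mul_add, add_mul, Finset.sum_add_distrib, hlow, hsw,
    sum_metricCoeff_mul_christoffel hu]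
  rw [← hsymm]
  have hsplit : ∑ j, ∑ p, ∑ q, 1 / 2 * (metricCoeffDeriv x₀ u p q j + metricCoeffDeriv x₀ u q p j -
        metricCoeffDeriv x₀ u j p q) * Y q * a p * Y j
      = 1 / 2 * (∑ j, ∑ p, ∑ q, metricCoeffDeriv x₀ u p q j * Y q * a p * Y j) +
        1 / 2 * (∑ j, ∑ p, ∑ q, metricCoeffDeriv x₀ u q p j * Y q * a p * Y j) -
        1 / 2 * (∑ j, ∑ p, ∑ q, metricCoeffDeriv x₀ u j p q * Y q * a p * Y j) := by
    simp only [Finset.mul_sum, ← Finset.sum_add_distrib, ← Finset.sum_sub_distrib]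
    refine Finset.sum_congr rfl fun j _ => Finset.sum_congr rfl fun p _ =>
      Finset.sum_congr rfl fun q _ => ?_
    ring
  rw [hsplit, hanti]
  ring

/-- The trace of the covariant derivative in the coordinates is the divergence. -/
lemma trace_coordCovDeriv {X : Π x : M, TangentSpace (𝓡 n) x} {x₀ : M} {u : E}
    (hu : u ∈ (extChartAt (𝓡 n) x₀).target)
    (hg : ∀ i j, DifferentiableAt ℝ (fun v => metricCoeff x₀ v i j) u) :
    LinearMap.trace ℝ E (coordCovDeriv X x₀ u).toLinearMap =
      coordDiv (coordField X x₀) (fun v => (metricCoeff x₀ v).det) u := by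
  have hd0 := (det_metricCoeff_pos hu).ne'
  have hdet := (hasFDerivAt_det (fun i j => (hg i j).hasFDerivAt) hd0).fderiv
  rw [coordCovDeriv, coordDiv, ContinuousLinearMap.toLinearMap_add, map_add, hdet]
  congr 1
  rw [trace_eq_sum]
  set Y := coordField X x₀ u
  have h1 : ∀ k i, fderiv ℝ (fun v => metricCoeff x₀ v k i) u Y
      = ∑ j, Y j * metricCoeffDeriv x₀ u j k i := by
    intro k i
    conv_lhs => rw [← sum_smul_single Y, map_sum]
    simp [metricCoeffDeriv]
  have h2 : ∀ k, (Matrix.toEuclideanCLM (𝕜 := ℝ) (Matrix.of fun k i => ∑ j,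
      christoffel x₀ u k i j * Y j) (EuclideanSpace.single k 1)) k
      = ∑ j, christoffel x₀ u k k j * Y j := by
    intro k
    rw [Matrix.ofLp_toEuclideanCLM]
    simp [Matrix.mulVec_single]
  simp only [h2]
  rw [Finset.sum_comm]
  simp only [← Finset.sum_mul, sum_christoffel, smul_apply, sum_apply, smul_eq_mul, h1]
  rw [mul_comm 2, mul_div_mul_left _ _ hd0]
  simp only [Finset.mul_sum, Finset.sum_mul, Finset.sum_div]
  conv_lhs =>
    enter [2, j]
    rw [Finset.sum_comm]
  rw [Finset.sum_comm]
  refine Finset.sum_congr rfl fun k _ => ?_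
  rw [Finset.sum_comm]
  refine Finset.sum_congr rfl fun i _ => Finset.sum_congr rfl fun j _ => ?_
  rw [metricCoeffDeriv_symm x₀ u j i k]; ring

omit [RiemannianBundle (fun x : M => TangentSpace (𝓡 n) x)] in
lemma isInvertible_toCoord (x : M) : (toCoord (n := n) x x).IsInvertible :=
  isInvertible_mfderiv_extChartAt (mem_extChartAt_source (I := 𝓡 n) x)

lemma toCoord_covDeriv (X : Π x : M, TangentSpace (𝓡 n) x) (x : M) (v : TangentSpace (𝓡 n) x) :
    toCoord x x (covDeriv X x v) = coordCovDeriv X x (extChartAt (𝓡 n) x x) (toCoord x x v) := by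
  change toCoord x x ((toCoord x x).inverse
    (coordCovDeriv X x (extChartAt (𝓡 n) x x) (toCoord x x v))) = _
  exact (isInvertible_toCoord x).self_apply_inverse _

/-- The trace of `∇X` is the divergence of `X`. -/
lemma trace_covDeriv {X : Π x : M, TangentSpace (𝓡 n) x} {x : M}
    (hg : ∀ i j, DifferentiableAt ℝ (fun v => metricCoeff x v i j) (extChartAt (𝓡 n) x x)) :
    LinearMap.trace ℝ (TangentSpace (𝓡 n) x) (covDeriv X x).toLinearMap =
      coordDiv (coordField X x) (fun v => (metricCoeff x v).det) (extChartAt (𝓡 n) x x) := by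
  rw [← trace_coordCovDeriv (mem_extChartAt_target x) hg]
  set C := coordCovDeriv X x (extChartAt (𝓡 n) x x)
  have h1 : (covDeriv X x).toLinearMap =
      (toCoord x x).inverse.toLinearMap ∘ₗ (C.toLinearMap ∘ₗ (toCoord x x).toLinearMap) := rfl
  rw [h1, LinearMap.trace_comp_comm', LinearMap.comp_assoc]
  have h2 : (toCoord (n := n) x x).toLinearMap ∘ₗ
      (toCoord (n := n) x x).inverse.toLinearMap = LinearMap.id := by
    ext1 a
    exact (isInvertible_toCoord x).self_apply_inverse a
  rw [h2, LinearMap.comp_id]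

lemma norm_sq_eq_sum_coordField {X : Π x : M, TangentSpace (𝓡 n) x} {x₀ : M} {u : E}
    (hu : u ∈ (extChartAt (𝓡 n) x₀).target) :
    ‖X ((extChartAt (𝓡 n) x₀).symm u)‖ ^ 2 =
      ∑ i, ∑ j, metricCoeff x₀ u i j * coordField X x₀ u i * coordField X x₀ u j := by
  rw [← real_inner_self_eq_norm_sq, inner_eq_sum_metricCoeff ((extChartAt (𝓡 n) x₀).map_target hu),
    (extChartAt (𝓡 n) x₀).right_inv hu]
  rfl

/-- The covariant derivative of a unit field is orthogonal to the field. -/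
lemma inner_covDeriv_eq_zero {X : Π x : M, TangentSpace (𝓡 n) x} {x : M}
    (hg : ∀ i j, DifferentiableAt ℝ (fun v => metricCoeff x v i j) (extChartAt (𝓡 n) x x))
    (hX : DifferentiableAt ℝ (coordField X x) (extChartAt (𝓡 n) x x))
    (hunit : ∀ᶠ y in 𝓝 x, ‖X y‖ = 1) (v : TangentSpace (𝓡 n) x) :
    inner ℝ (covDeriv X x v) (X x) = 0 := by
  have hmem := mem_extChartAt_source (I := 𝓡 n) x
  have htar := mem_extChartAt_target (I := 𝓡 n) x
  have h1 := two_mul_sum_metricCoeff_coordCovDeriv htar hg hX (toCoord x x v)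
  have h2 : (fun w => ∑ i, ∑ j, metricCoeff x w i j * coordField X x w i * coordField X x w j)
      =ᶠ[𝓝 (extChartAt (𝓡 n) x x)] fun _ => (1 : ℝ) := by
    have hc : Tendsto (extChartAt (𝓡 n) x).symm (𝓝 (extChartAt (𝓡 n) x x)) (𝓝 x) := by
      have := (mdifferentiableAt_extChartAt_symm htar).continuousAt
      rwa [ContinuousAt, (extChartAt (𝓡 n) x).left_inv hmem] at this
    filter_upwards [hc.eventually hunit, (isOpen_extChartAt_target x).eventually_mem htar]
      with w hw hwt
    rw [← norm_sq_eq_sum_coordField hwt, hw, one_pow]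
  rw [h2.fderiv_eq] at h1
  rw [inner_eq_sum_metricCoeff hmem]
  simp only [toCoord_covDeriv, ← coordField_extChartAt X hmem]
  simpa using h1

end LeviCivita

/-! ### Smoothness of determinants and inverse matrices -/

section Smoothness

lemma contDiffOn_det {F : Type*} [NormedAddCommGroup F] [NormedSpace ℝ F] {ι : Type*} [Fintype ι]
    [DecidableEq ι] {k : WithTop ℕ∞} {A : F → Matrix ι ι ℝ} {s : Set F}
    (h : ∀ i j, ContDiffOn ℝ k (fun v => A v i j) s) : ContDiffOn ℝ k (fun v => (A v).det) s := by
  simp only [Matrix.det_apply]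
  exact ContDiffOn.sum fun σ _ => (contDiffOn_prod fun i _ => h _ _).const_smul _

lemma contDiffOn_inv_apply {F : Type*} [NormedAddCommGroup F] [NormedSpace ℝ F] {ι : Type*}
    [Fintype ι] [DecidableEq ι] {k : WithTop ℕ∞} {A : F → Matrix ι ι ℝ} {s : Set F}
    (h : ∀ i j, ContDiffOn ℝ k (fun v => A v i j) s) (h0 : ∀ v ∈ s, (A v).det ≠ 0) (i j : ι) :
    ContDiffOn ℝ k (fun v => (A v)⁻¹ i j) s := by
  simp only [Matrix.inv_def, Matrix.smul_apply, Ring.inverse_eq_inv', smul_eq_mul,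
    Matrix.adjugate_apply]
  refine ((contDiffOn_det h).inv h0).mul (contDiffOn_det fun k l => ?_)
  by_cases hk : k = j
  · subst hk; simp only [Matrix.updateRow_self]; exact contDiffOn_const
  · simp only [Matrix.updateRow_ne hk]; exact h k l

end Smoothness

/-! ### Vector fields in charts -/

section Fields

variable {n : ℕ} {M : Type*} [TopologicalSpace M] [ChartedSpace (EuclideanSpace ℝ (Fin n)) M]
  [IsManifold (𝓡 n) ∞ M]

local notation "E" => EuclideanSpace ℝ (Fin n)

omit [IsManifold (𝓡 n) ∞ M] in
/-- The part of the coordinate domain which corresponds to an open subset of the manifold. -/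
lemma isOpen_target_inter_preimage (x₀ : M) {Ω : Set M} (hΩ : IsOpen Ω) :
    IsOpen ((extChartAt (𝓡 n) x₀).target ∩ (extChartAt (𝓡 n) x₀).symm ⁻¹' Ω) :=
  (continuousOn_extChartAt_symm x₀).isOpen_inter_preimage (isOpen_extChartAt_target x₀) hΩ

/-- A continuous section of the tangent bundle has continuous components in every chart. -/
lemma continuousOn_coordField {X : Π x : M, TangentSpace (𝓡 n) x} {Ω : Set M}
    (hX : ContinuousOn (fun x => (⟨x, X x⟩ : TangentBundle (𝓡 n) M)) Ω) (x₀ : M) :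
    ContinuousOn (coordField X x₀)
      ((extChartAt (𝓡 n) x₀).target ∩ (extChartAt (𝓡 n) x₀).symm ⁻¹' Ω) := by
  have h1 := (trivializationAt E (TangentSpace (𝓡 n)) x₀).continuousOn
  have h2 := hX.comp ((continuousOn_extChartAt_symm x₀).mono inter_subset_left)
    (fun u (hu : u ∈ (extChartAt (𝓡 n) x₀).target ∩ (extChartAt (𝓡 n) x₀).symm ⁻¹' Ω) => hu.2)
  have hsrc : ∀ u ∈ (extChartAt (𝓡 n) x₀).target ∩ (extChartAt (𝓡 n) x₀).symm ⁻¹' Ω,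
      (extChartAt (𝓡 n) x₀).symm u ∈ (chartAt E x₀).source := fun u hu => by
    rw [← extChartAt_source (𝓡 n)]; exact (extChartAt (𝓡 n) x₀).map_target hu.1
  have h3 := continuous_snd.comp_continuousOn (h1.comp h2 (fun u hu => by
    rw [Trivialization.mem_source]; simpa using hsrc u hu))
  refine h3.congr fun u hu => ?_
  have h4 := TangentBundle.continuousLinearMapAt_trivializationAt (I := 𝓡 n) (hsrc u hu)
  have h5 : coordField X x₀ u =
    (trivializationAt E (TangentSpace (𝓡 n)) x₀).continuousLinearMapAt ℝ
      ((extChartAt (𝓡 n) x₀).symm u) (X ((extChartAt (𝓡 n) x₀).symm u)) := by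
    rw [h4]; rfl
  rw [h5, Trivialization.continuousLinearMapAt_apply,
    Trivialization.coe_linearMapAt_of_mem _ (by simpa using hsrc u hu)]
  rfl

variable [RiemannianBundle (fun x : M => TangentSpace (𝓡 n) x)]
  [IsContMDiffRiemannianBundle (𝓡 n) ∞ (EuclideanSpace ℝ (Fin n))
      (fun x : M => TangentSpace (𝓡 n) x)]

lemma contDiffOn_metricCoeff_inv (x₀ : M) (i j : Fin n) :
    ContDiffOn ℝ ∞ (fun u => (metricCoeff x₀ u)⁻¹ i j) (extChartAt (𝓡 n) x₀).target :=
  contDiffOn_inv_apply (contDiffOn_metricCoeff x₀) (fun _ hv => (det_metricCoeff_pos hv).ne') i j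

lemma contDiffOn_det_metricCoeff (x₀ : M) :
    ContDiffOn ℝ ∞ (fun u => (metricCoeff x₀ u).det) (extChartAt (𝓡 n) x₀).target :=
  contDiffOn_det (contDiffOn_metricCoeff x₀)

lemma differentiableAt_metricCoeff {x₀ : M} {u : E} (hu : u ∈ (extChartAt (𝓡 n) x₀).target)
    (i j : Fin n) : DifferentiableAt ℝ (fun v => metricCoeff x₀ v i j) u :=
  ((contDiffOn_metricCoeff x₀ i j).contDiffAt
    ((isOpen_extChartAt_target x₀).mem_nhds hu)).differentiableAt (by simp)

omit [IsContMDiffRiemannianBundle (𝓡 n) ∞ (EuclideanSpace ℝ (Fin n))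
      (fun x : M => TangentSpace (𝓡 n) x)] in
/-- The index of a linear form is raised by the inverse of the metric. -/
lemma toCoord_eq_sum_inv {x₀ x : M} (hx : x ∈ (extChartAt (𝓡 n) x₀).source)
    (v : TangentSpace (𝓡 n) x) (p : E →L[ℝ] ℝ) (h : ∀ w, inner ℝ v w = p (toCoord x₀ x w))
    (i : Fin n) :
    toCoord x₀ x v i = ∑ j, (metricCoeff x₀ (extChartAt (𝓡 n) x₀ x))⁻¹ i j *
      p (EuclideanSpace.single j 1) := by
  set g := metricCoeff x₀ (extChartAt (𝓡 n) x₀ x)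
  have h1 : ∀ j, ∑ i, g i j * toCoord x₀ x v i = p (EuclideanSpace.single j 1) := by
    intro j
    obtain ⟨w, hw⟩ := (toCoord_bijective hx).2 (EuclideanSpace.single j (1 : ℝ))
    rw [← hw, ← h w, inner_eq_sum_metricCoeff hx, hw]
    refine Finset.sum_congr rfl fun i _ => ?_
    simp [g]
  have hinv : g⁻¹ * g = 1 :=
    Matrix.nonsing_inv_mul _ (det_metricCoeff_pos ((extChartAt (𝓡 n) x₀).map_source hx)).ne'.isUnit
  calc toCoord x₀ x v i = ∑ k, (g⁻¹ * g) i k * toCoord x₀ x v k := by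
        rw [hinv]; simp [Matrix.one_apply]
    _ = ∑ j, g⁻¹ i j * ∑ k, g k j * toCoord x₀ x v k := by
        simp only [Matrix.mul_apply, Finset.sum_mul, Finset.mul_sum]
        rw [Finset.sum_comm]
        refine Finset.sum_congr rfl fun j _ => Finset.sum_congr rfl fun k _ => ?_
        rw [show g j k = g k j from metricCoeff_symm x₀ _ j k]; ring
    _ = _ := by simp only [h1]

end Fields

/-! ### Tangent spaces of the leaves -/

section FoliationTangent

variable {m : ℕ} {M : Type*} [TopologicalSpace M] [ChartedSpace (EuclideanSpace ℝ (Fin (m + 1))) M]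
  {Ω : Set M} (𝓕 : Foliation m Ω)

namespace Foliation

variable {𝓕}

lemma mdifferentiable_of_mem_atlas {e : OpenPartialHomeomorph M (EuclideanSpace ℝ (Fin m) × ℝ)}
    (he : e ∈ 𝓕.atlas) : e.MDifferentiable (𝓡 (m + 1)) 𝓘(ℝ, EuclideanSpace ℝ (Fin m) × ℝ) :=
  ⟨(𝓕.contMDiffOn e he).mdifferentiableOn (by norm_num),
    (𝓕.contMDiffOn_symm e he).mdifferentiableOn (by norm_num)⟩

lemma source_subset {e : OpenPartialHomeomorph M (EuclideanSpace ℝ (Fin m) × ℝ)}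
    (he : e ∈ 𝓕.atlas) : e.source ⊆ Ω := by
  rw [← 𝓕.iUnion_source]; exact subset_biUnion_of_mem (u := fun e => e.source) he

lemma exists_chart {x : M} (hx : x ∈ Ω) : ∃ e ∈ 𝓕.atlas, x ∈ e.source := by
  rw [← 𝓕.iUnion_source] at hx; simpa using hx

lemma contMDiffOn_snd {e : OpenPartialHomeomorph M (EuclideanSpace ℝ (Fin m) × ℝ)}
    (he : e ∈ 𝓕.atlas) : ContMDiffOn (𝓡 (m + 1)) 𝓘(ℝ, ℝ) 2 (fun z => (e z).2) e.source :=
  (contDiff_snd (𝕜 := ℝ) (E := EuclideanSpace ℝ (Fin m)) (F := ℝ)).contMDiff.comp_contMDiffOn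
    (𝓕.contMDiffOn e he)

lemma mdifferentiableAt_snd {e : OpenPartialHomeomorph M (EuclideanSpace ℝ (Fin m) × ℝ)}
    (he : e ∈ 𝓕.atlas) {x : M} (hx : x ∈ e.source) :
    MDifferentiableAt (𝓡 (m + 1)) 𝓘(ℝ, ℝ) (fun z => (e z).2) x :=
  ((contMDiffOn_snd he).contMDiffAt (e.open_source.mem_nhds hx)).mdifferentiableAt (by norm_num)

lemma diff_snd_apply {e : OpenPartialHomeomorph M (EuclideanSpace ℝ (Fin m) × ℝ)}
    (he : e ∈ 𝓕.atlas) {x : M} (hx : x ∈ e.source) (v : TangentSpace (𝓡 (m + 1)) x) :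
    diff (fun z => (e z).2) x v = (diff e x v).2 := by
  have h1 := ((mdifferentiable_of_mem_atlas he).mdifferentiableAt hx).hasMFDerivAt
  have h2 := (ContinuousLinearMap.snd ℝ (EuclideanSpace ℝ (Fin m)) ℝ).hasMFDerivAt (x := e x)
  exact DFunLike.congr_fun (h2.comp x h1).mfderiv v

/-- Directions tangent to a plaque of one foliated chart are tangent to the plaques of any other
chart, since the transverse coordinates are functions of each other. -/
lemma diff_snd_eq_zero {e e' : OpenPartialHomeomorph M (EuclideanSpace ℝ (Fin m) × ℝ)}
    (he : e ∈ 𝓕.atlas) (he' : e' ∈ 𝓕.atlas) {x : M} (hx : x ∈ e.source) (hx' : x ∈ e'.source)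
    {v : TangentSpace (𝓡 (m + 1)) x} (hv : diff (fun z => (e z).2) x v = 0) :
    diff (fun z => (e' z).2) x v = 0 := by
  obtain ⟨h, hh⟩ := 𝓕.compatible e he e' he' x ⟨hx, hx'⟩
  set t' : M → ℝ := fun z => (e' z).2
  set w := diff e x v with hw
  have hw2 : w.2 = 0 := by rw [hw, ← diff_snd_apply he hx, hv]
  have hex : e x ∈ e.target := e.map_source hx
  have hsymm := (mdifferentiable_of_mem_atlas he).mdifferentiableAt_symm hex
  have ht' : MDifferentiableAt (𝓡 (m + 1)) 𝓘(ℝ, ℝ) t' (e.symm (e x)) := by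
    rw [e.left_inv hx]; exact mdifferentiableAt_snd he' hx'
  have hq : DifferentiableAt ℝ (t' ∘ e.symm) (e x) :=
    (ht'.comp (e x) hsymm).differentiableAt
  have heq : t' =ᶠ[𝓝 x] (t' ∘ e.symm) ∘ e := by
    filter_upwards [e.open_source.mem_nhds hx] with z hz
    simp [e.left_inv hz]
  have hchain : diff t' x v = fderiv ℝ (t' ∘ e.symm) (e x) w := by
    have h1 := ((mdifferentiable_of_mem_atlas he).mdifferentiableAt hx).hasMFDerivAt
    have h2 := hq.hasFDerivAt.hasMFDerivAt
    have h3 := ((h2.comp x h1).congr_of_eventuallyEq heq).mfderiv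
    exact DFunLike.congr_fun h3 v
  -- along the plaque through `x` in the direction `w`, the coordinate `t'` is constant
  have hline : HasDerivAt (fun s : ℝ => (t' ∘ e.symm) (e x + s • w))
      (fderiv ℝ (t' ∘ e.symm) (e x) w) 0 := hq.hasFDerivAt.hasLineDerivAt w
  have hcont : Tendsto (fun s : ℝ => e x + s • w) (𝓝 0) (𝓝 (e x)) := by
    have : Continuous fun s : ℝ => e x + s • w := by fun_prop
    simpa using this.tendsto 0
  have hsy : Tendsto (fun s : ℝ => e.symm (e x + s • w)) (𝓝 0) (𝓝 x) := by
    have := (e.continuousAt_symm hex).tendsto.comp hcont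
    rwa [e.left_inv hx] at this
  have hconst : (fun s : ℝ => (t' ∘ e.symm) (e x + s • w)) =ᶠ[𝓝 0] fun _ => h (e x).2 := by
    filter_upwards [hsy.eventually hh, hcont.eventually (e.open_target.mem_nhds hex)] with s hs hst
    simp only [Function.comp_apply, t']
    rw [hs, e.right_inv hst]
    simp [hw2]
  rw [hchain]
  exact hline.unique ((hasDerivAt_const _ _).congr_of_eventuallyEq hconst)

/-- The tangent space of the leaf is the kernel of `dt` for any single foliated chart around the
point; the other charts impose no further condition. -/
lemma tangentSpace_eq_ker {e : OpenPartialHomeomorph M (EuclideanSpace ℝ (Fin m) × ℝ)}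
    (he : e ∈ 𝓕.atlas) {x : M} (hx : x ∈ e.source) :
    𝓕.tangentSpace x = LinearMap.ker (diff (fun z => (e z).2) x).toLinearMap := by
  apply le_antisymm
  · exact iInf₂_le e (show e ∈ {e ∈ 𝓕.atlas | x ∈ e.source} from ⟨he, hx⟩)
  · refine le_iInf₂ fun e' he' => ?_
    intro v hv
    exact diff_snd_eq_zero he he'.1 hx he'.2 hv

end Foliation

end FoliationTangent

/-! ### The mean curvature as a divergence -/

section MeanCurvature

variable {m : ℕ} {M : Type*} [TopologicalSpace M] [ChartedSpace (EuclideanSpace ℝ (Fin (m + 1))) M]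
  [IsManifold (𝓡 (m + 1)) ∞ M] [RiemannianBundle (fun x : M => TangentSpace (𝓡 (m + 1)) x)]
  {Ω : Set M} {𝓕 : Foliation m Ω} {η : Π x : M, TangentSpace (𝓡 (m + 1)) x}

local notation "E" => EuclideanSpace ℝ (Fin (m + 1))

namespace Foliation

/-- The differential of the transverse coordinate is `dt = dt(η) ⟨η, ·⟩`. -/
lemma IsUnitNormal.diff_snd_eq (hη : 𝓕.IsUnitNormal η)
    {e : OpenPartialHomeomorph M (EuclideanSpace ℝ (Fin m) × ℝ)} (he : e ∈ 𝓕.atlas) {x : M}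
    (hx : x ∈ e.source) :
    diff (fun z => (e z).2) x (η x) ≠ 0 ∧ ∀ v, diff (fun z => (e z).2) x v =
      diff (fun z => (e z).2) x (η x) * inner ℝ (η x) v := by
  set ℓ := diff (n := m + 1) (fun z => (e z).2) x with hℓ
  have hxΩ := source_subset he hx
  have hker : ∀ v, ℓ v = 0 → inner ℝ (η x) v = 0 := fun v hv =>
    hη.normal x hxΩ v (by rw [tangentSpace_eq_ker he hx]; exact hv)
  have hunit : inner ℝ (η x) (η x) = (1 : ℝ) := by
    rw [real_inner_self_eq_norm_sq, hη.norm_eq_one x hxΩ]; norm_num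
  have h0 : ℓ (η x) ≠ 0 := by
    intro h
    rw [hker _ h] at hunit
    norm_num at hunit
  refine ⟨h0, fun v => ?_⟩
  have h1 := hker (v - (ℓ v / ℓ (η x)) • η x) (by
    rw [map_sub, map_smul, smul_eq_mul]; field_simp; ring)
  rw [inner_sub_right, inner_smul_right, hunit] at h1
  have h2 : inner ℝ (η x) v = ℓ v / ℓ (η x) := by linarith
  rw [h2]; field_simp

variable [IsContMDiffRiemannianBundle (𝓡 (m + 1)) ∞ (EuclideanSpace ℝ (Fin (m + 1)))
      (fun x : M => TangentSpace (𝓡 (m + 1)) x)]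

/-- A continuous unit normal field of a foliation of class `C²` is of class `C¹`: it is
`± ∇t / |∇t|` for the transverse coordinate `t`, and the sign is locally constant. -/
lemma IsUnitNormal.contDiffAt_coordField (hη : 𝓕.IsUnitNormal η) (hΩ : IsOpen Ω) {x₀ : M} {u : E}
    (hu : u ∈ (extChartAt (𝓡 (m + 1)) x₀).target ∩ (extChartAt (𝓡 (m + 1)) x₀).symm ⁻¹' Ω) :
    ContDiffAt ℝ 1 (coordField η x₀) u := by
  set ψ := extChartAt (𝓡 (m + 1)) x₀ with hψ
  obtain ⟨e, he, hxe⟩ := exists_chart (𝓕 := 𝓕) hu.2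
  set t : M → ℝ := fun z => (e z).2
  set U := ψ.target ∩ ψ.symm ⁻¹' e.source with hU
  have hUo : IsOpen U := isOpen_target_inter_preimage x₀ e.open_source
  have huU : u ∈ U := ⟨hu.1, hxe⟩
  have hUn : U ∈ 𝓝 u := hUo.mem_nhds huU
  set f : E → ℝ := t ∘ ψ.symm with hf
  have hfC : ContDiffOn ℝ 2 f U := by
    have h1 := (contMDiffOn_extChartAt_symm (I := 𝓡 (m + 1)) (n := 2) x₀).mono
      (inter_subset_left (s := ψ.target) (t := ψ.symm ⁻¹' e.source))
    exact ((contMDiffOn_snd he).comp h1 fun v hv => hv.2).contDiffOn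
  have hdf : ContDiffOn ℝ 1 (fderiv ℝ f) U := hfC.fderiv_of_isOpen hUo (by norm_num)
  set Y := coordField η x₀ with hY
  set p : Fin (m + 1) → E → ℝ := fun j v => fderiv ℝ f v (EuclideanSpace.single j 1) with hp
  have hpC : ∀ j, ContDiffOn ℝ 1 (p j) U := fun j => hdf.clm_apply contDiffOn_const
  -- the components of the gradient of the transverse coordinate
  set w : Fin (m + 1) → E → ℝ := fun i v => ∑ j, (metricCoeff x₀ v)⁻¹ i j * p j v with hw
  have hwC : ∀ i, ContDiffOn ℝ 1 (w i) U := fun i => ContDiffOn.sum fun j _ =>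
    (((contDiffOn_metricCoeff_inv x₀ i j).mono inter_subset_left).of_le (by norm_cast)).mul (hpC j)
  -- `η = s⁻¹ ∇t` with `s = dt(η)`, which is continuous and nowhere zero
  set s : E → ℝ := fun v => fderiv ℝ f v (Y v) with hs
  have hfd : ∀ v ∈ U, ∀ z : TangentSpace (𝓡 (m + 1)) (ψ.symm v),
      fderiv ℝ f v (toCoord x₀ (ψ.symm v) z) = diff t (ψ.symm v) z := by
    intro v hv z
    rw [fderiv_comp_extChartAt_symm hv.1 (mdifferentiableAt_snd he hv.2), ofCoord_toCoord hv.1]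
  have hs_eq : ∀ v ∈ U, s v = diff t (ψ.symm v) (η (ψ.symm v)) := fun v hv => hfd v hv _
  have hs0 : ∀ v ∈ U, s v ≠ 0 := fun v hv => by
    rw [hs_eq v hv]; exact (hη.diff_snd_eq he hv.2).1
  have hYw : ∀ v ∈ U, ∀ i, Y v i = (s v)⁻¹ * w i v := by
    intro v hv i
    have h1 := toCoord_eq_sum_inv (ψ.map_target hv.1) (η (ψ.symm v)) ((s v)⁻¹ • fderiv ℝ f v)
      (fun z => by
        rw [smul_apply, hfd v hv, (hη.diff_snd_eq he hv.2).2 z, ← hs_eq v hv, smul_eq_mul,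
          inv_mul_cancel_left₀ (hs0 v hv)]) i
    rw [ψ.right_inv hv.1] at h1
    change toCoord x₀ (ψ.symm v) (η (ψ.symm v)) i = _
    rw [h1, hw, Finset.mul_sum]
    refine Finset.sum_congr rfl fun j _ => ?_
    rw [smul_apply, smul_eq_mul, hp]; ring
  -- `s² = |∇t|²` is of class `C¹`, although `s` itself is only known to be continuous so far
  have hsq : ∀ v ∈ U, s v ^ 2 = ∑ i, w i v * p i v := by
    intro v hv
    have h1 : s v = ∑ i, Y v i * p i v := by
      simp only [hs, hp]
      conv_lhs => rw [← sum_smul_single (Y v), map_sum]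
      simp
    have h2 : ∑ i, Y v i * p i v = (s v)⁻¹ * ∑ i, w i v * p i v := by
      rw [Finset.mul_sum]
      exact Finset.sum_congr rfl fun i _ => by rw [hYw v hv]; ring
    have h3 := hs0 v hv
    rw [h2] at h1
    field_simp at h1
    exact h1
  have hq : ContDiffAt ℝ 1 (fun v => ∑ i, w i v * p i v) u :=
    ContDiffAt.sum fun i _ => ((hwC i).contDiffAt hUn).mul ((hpC i).contDiffAt hUn)
  have hq0 : ∑ i, w i u * p i u ≠ 0 := by rw [← hsq u huU]; exact pow_ne_zero 2 (hs0 u huU)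
  have hsc : ContinuousAt s u := by
    have h1 : ContinuousAt Y u := (continuousOn_coordField hη.continuousOn x₀).continuousAt
      ((isOpen_target_inter_preimage x₀ hΩ).mem_nhds hu)
    exact (hdf.continuousOn.continuousAt hUn).clm_apply h1
  have hsC : ContDiffAt ℝ 1 s u := by
    have hsqrt := hq.sqrt hq0
    rcases lt_or_gt_of_ne (hs0 u huU) with h | h
    · refine hsqrt.neg.congr_of_eventuallyEq ?_
      filter_upwards [hsc.eventually_lt_const h, hUn] with v hv hvU
      rw [← hsq v hvU, Real.sqrt_sq_eq_abs, abs_of_neg hv, neg_neg]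
    · refine hsqrt.congr_of_eventuallyEq ?_
      filter_upwards [hsc.eventually_const_lt h, hUn] with v hv hvU
      rw [← hsq v hvU, Real.sqrt_sq hv.le]
  rw [contDiffAt_piLp]
  intro i
  refine ((hsC.inv (hs0 u huU)).mul ((hwC i).contDiffAt hUn)).congr_of_eventuallyEq ?_
  filter_upwards [hUn] with v hv
  exact hYw v hv i

/-- The mean curvature of the leaves is the divergence of the unit normal field; the divergence may
be computed in any chart. -/
lemma IsUnitNormal.meanCurvature_eq_coordDiv (hη : 𝓕.IsUnitNormal η) (hΩ : IsOpen Ω) {x₀ x : M}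
    (hx : x ∈ Ω) (hx₀ : x ∈ (extChartAt (𝓡 (m + 1)) x₀).source) :
    𝓕.meanCurvature η x = coordDiv (coordField η x₀) (fun v => (metricCoeff x₀ v).det)
      (extChartAt (𝓡 (m + 1)) x₀ x) := by
  have hmem := mem_extChartAt_source (I := 𝓡 (m + 1)) x
  have htar := mem_extChartAt_target (I := 𝓡 (m + 1)) x
  have hmemU : ∀ y, x ∈ (extChartAt (𝓡 (m + 1)) y).source → extChartAt (𝓡 (m + 1)) y x ∈
      (extChartAt (𝓡 (m + 1)) y).target ∩ (extChartAt (𝓡 (m + 1)) y).symm ⁻¹' Ω := fun y hy =>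
    ⟨(extChartAt (𝓡 (m + 1)) y).map_source hy, by
      rw [mem_preimage, (extChartAt (𝓡 (m + 1)) y).left_inv hy]; exact hx⟩
  have hYd : ∀ y, x ∈ (extChartAt (𝓡 (m + 1)) y).source →
      DifferentiableAt ℝ (coordField η y) (extChartAt (𝓡 (m + 1)) y x) := fun y hy =>
    (hη.contDiffAt_coordField hΩ (hmemU y hy)).differentiableAt (by norm_num)
  have hgd := differentiableAt_metricCoeff htar
  obtain ⟨e, he, hxe⟩ := exists_chart (𝓕 := 𝓕) hx
  have htr := trace_eq_trace_compress_add_inner (𝓕.tangentSpace x) (η x) (hη.norm_eq_one x hx)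
    (diff (fun z => (e z).2) x).toLinearMap (tangentSpace_eq_ker he hxe) (hη.normal x hx)
    (covDeriv η x).toLinearMap
  have hort : inner ℝ (η x) (covDeriv η x (η x)) = 0 := by
    rw [real_inner_comm]
    exact inner_covDeriv_eq_zero hgd (hYd x hmem)
      ((hΩ.eventually_mem hx).mono fun y hy => hη.norm_eq_one y hy) _
  have hH : 𝓕.meanCurvature η x = LinearMap.trace ℝ _ (covDeriv η x).toLinearMap := by
    rw [htr]
    change _ = 𝓕.meanCurvature η x + inner ℝ (η x) (covDeriv η x (η x))
    rw [hort, add_zero]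
  rw [hH, trace_covDeriv hgd]
  have hτ := contDiffAt_transition hmem hx₀
  have hτx := transition_extChartAt (x₁ := x₀) hmem
  rw [← hτx]
  have hnear : ∀ᶠ v in 𝓝 (extChartAt (𝓡 (m + 1)) x x), ∃ y, y ∈ (extChartAt (𝓡 (m + 1)) x).source ∧
      y ∈ (extChartAt (𝓡 (m + 1)) x₀).source ∧ extChartAt (𝓡 (m + 1)) x y = v := by
    filter_upwards [(isOpen_target_inter_preimage x (isOpen_extChartAt_source x₀)).mem_nhds
      (show extChartAt (𝓡 (m + 1)) x x ∈ _ from ⟨htar, by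
        rw [mem_preimage, (extChartAt (𝓡 (m + 1)) x).left_inv hmem]; exact hx₀⟩)] with v hv
    exact ⟨_, (extChartAt (𝓡 (m + 1)) x).map_target hv.1, hv.2,
      (extChartAt (𝓡 (m + 1)) x).right_inv hv.1⟩
  refine coordDiv_eq_of_transition (hτ.of_le (by norm_cast)) (transition_leftInverse hmem hx₀)
    (hYd x hmem) (by rw [hτx]; exact hYd x₀ hx₀) ?_ ?_ ?_ ?_
  · rw [hτx]
    have ht := (extChartAt (𝓡 (m + 1)) x₀).map_source hx₀
    exact ((contDiffOn_det_metricCoeff x₀).contDiffAt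
      ((isOpen_extChartAt_target x₀).mem_nhds ht)).differentiableAt (by simp)
  · rw [hτx]
    exact (det_metricCoeff_pos ((extChartAt (𝓡 (m + 1)) x₀).map_source hx₀)).ne'
  · filter_upwards [hnear] with v ⟨y, hy, hy₀, hv⟩
    rw [← hv, transition_extChartAt hy, coordField_extChartAt η hy₀, coordField_extChartAt η hy,
      ← toCoord_eq_transition hy hy₀]
  · filter_upwards [hnear] with v ⟨y, hy, hy₀, hv⟩
    rw [← hv, transition_extChartAt hy, det_metricCoeff_transition hy hy₀]

/-- The definition of `H` uses a different chart at each point; continuity at `x` holds because near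
`x` it is the divergence of `η` in the one fixed chart at `x`. -/
lemma IsUnitNormal.continuousOn_meanCurvature (hη : 𝓕.IsUnitNormal η) (hΩ : IsOpen Ω) :
    ContinuousOn (𝓕.meanCurvature η) Ω := by
  intro x hx
  refine ContinuousAt.continuousWithinAt ?_
  set ψ := extChartAt (𝓡 (m + 1)) x with hψ
  have hmem := mem_extChartAt_source (I := 𝓡 (m + 1)) x
  have htar := mem_extChartAt_target (I := 𝓡 (m + 1)) x
  have hu : ψ x ∈ ψ.target ∩ ψ.symm ⁻¹' Ω :=
    ⟨htar, by rw [mem_preimage, ψ.left_inv hmem]; exact hx⟩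
  have heq : 𝓕.meanCurvature η =ᶠ[𝓝 x] fun y : M =>
      coordDiv (coordField η x) (fun v => (metricCoeff x v).det) (ψ y) := by
    filter_upwards [hΩ.mem_nhds hx, (isOpen_extChartAt_source (I := 𝓡 (m + 1)) x).mem_nhds hmem]
      with y hy hyx
    exact hη.meanCurvature_eq_coordDiv hΩ hy hyx
  suffices h : ContinuousAt (coordDiv (coordField η x) fun v => (metricCoeff x v).det) (ψ x) from
    ((h.comp (f := ψ) (continuousAt_extChartAt x))).congr_of_eventuallyEq heq
  have hY := hη.contDiffAt_coordField hΩ hu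
  have hd := ((contDiffOn_det_metricCoeff (M := M) x).contDiffAt
    ((isOpen_extChartAt_target x).mem_nhds htar))
  have hdY : ContinuousAt (fderiv ℝ (coordField η x)) (ψ x) :=
    (hY.fderiv_right (m := 0) (by norm_num)).continuousAt
  have hdd : ContinuousAt (fderiv ℝ fun v => (metricCoeff (M := M) x v).det) (ψ x) :=
    (hd.fderiv_right (m := 0) (by simp)).continuousAt
  unfold coordDiv
  refine ContinuousAt.add ?_ ?_
  · simp_rw [trace_eq_sum]
    refine tendsto_finsetSum _ fun i _ => ?_
    exact (EuclideanSpace.proj (𝕜 := ℝ) i).continuous.continuousAt.comp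
      (hdY.clm_apply continuousAt_const)
  · exact (hdd.clm_apply hY.continuousAt).div (continuousAt_const.mul hd.continuousAt)
      (mul_ne_zero two_ne_zero (det_metricCoeff_pos htar).ne')

end Foliation

end MeanCurvature

/-! ### The Riemannian volume -/

lemma measurableSet_inter_preimage_of_continuousOn {X Y : Type*} [TopologicalSpace X]
    [MeasurableSpace X] [OpensMeasurableSpace X] [TopologicalSpace Y] [MeasurableSpace Y]
    [BorelSpace Y] {f : X → Y} {s : Set X} (hs : MeasurableSet s) (hf : ContinuousOn f s)
    {t : Set Y} (ht : MeasurableSet t) : MeasurableSet (s ∩ f ⁻¹' t) := by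
  have h1 : MeasurableSet (s.domRestrict f ⁻¹' t) := hf.domRestrict.measurable ht
  have h2 := hs.subtype_image h1
  convert h2 using 1
  ext x
  exact ⟨fun h => ⟨⟨x, h.1⟩, h.2, rfl⟩, fun ⟨y, hy, hyx⟩ => hyx ▸ ⟨y.2, hy⟩⟩

section Volume

variable {n : ℕ} {M : Type*} [TopologicalSpace M] [ChartedSpace (EuclideanSpace ℝ (Fin n)) M]
  [IsManifold (𝓡 n) ∞ M]
  [RiemannianBundle (fun x : M => TangentSpace (𝓡 n) x)]
  [MeasurableSpace M] [BorelSpace M]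

local notation "E" => EuclideanSpace ℝ (Fin n)

/-- The volume density `√(det g)` in the preferred chart at `x₀`. -/
def volDensity (x₀ : M) (u : E) : ℝ≥0∞ := ENNReal.ofReal (√(metricCoeff x₀ u).det)

omit [IsManifold (𝓡 n) ∞ M] [RiemannianBundle (fun x : M => TangentSpace (𝓡 n) x)] in
lemma aemeasurable_extChartAt_symm (x₀ : M) (ρ : E → ℝ≥0∞) :
    AEMeasurable (extChartAt (𝓡 n) x₀).symm
      ((volume.restrict (extChartAt (𝓡 n) x₀).target).withDensity ρ) :=
  ((continuousOn_extChartAt_symm x₀).aemeasurable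
    (isOpen_extChartAt_target x₀).measurableSet).mono_ac (withDensity_absolutelyContinuous _ _)

omit [IsManifold (𝓡 n) ∞ M] in
lemma chartVolume_apply (x₀ : M) {s : Set M} (hs : MeasurableSet s) :
    chartVolume (n := n) x₀ s =
      ∫⁻ u in (extChartAt (𝓡 n) x₀).target ∩ (extChartAt (𝓡 n) x₀).symm ⁻¹' s,
        volDensity x₀ u := by
  rw [chartVolume, Measure.map_apply_of_aemeasurable (aemeasurable_extChartAt_symm x₀ _) hs,
    withDensity_apply', Measure.restrict_restrict' (isOpen_extChartAt_target x₀).measurableSet,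
    inter_comm]
  rfl

omit [IsManifold (𝓡 n) ∞ M] in
lemma chartVolume_inter_source (x₀ : M) {s : Set M} (hs : MeasurableSet s) :
    chartVolume (n := n) x₀ (s ∩ (extChartAt (𝓡 n) x₀).source) = chartVolume (n := n) x₀ s := by
  rw [chartVolume_apply x₀ hs,
    chartVolume_apply x₀ (hs.inter (isOpen_extChartAt_source x₀).measurableSet)]
  congr 2
  ext u
  exact ⟨fun h => ⟨h.1, h.2.1⟩, fun h => ⟨h.1, h.2, (extChartAt (𝓡 n) x₀).map_target h.1⟩⟩

/-- The volume measures of two charts agree on the overlap, by the change of variables formula. -/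
lemma chartVolume_eq_of_subset {x₀ x₁ : M} {s : Set M} (hs : MeasurableSet s)
    (h₀ : s ⊆ (extChartAt (𝓡 n) x₀).source) (h₁ : s ⊆ (extChartAt (𝓡 n) x₁).source) :
    chartVolume (n := n) x₀ s = chartVolume (n := n) x₁ s := by
  set ψ₀ := extChartAt (𝓡 n) x₀
  set ψ₁ := extChartAt (𝓡 n) x₁
  rw [chartVolume_apply x₀ hs, chartVolume_apply x₁ hs]
  set S := ψ₀.target ∩ ψ₀.symm ⁻¹' s with hS
  have hSm : MeasurableSet S := measurableSet_inter_preimage_of_continuousOn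
    (isOpen_extChartAt_target x₀).measurableSet (continuousOn_extChartAt_symm x₀) hs
  have himg : ψ₁.target ∩ ψ₁.symm ⁻¹' s = transition x₀ x₁ '' S := by
    ext w
    constructor
    · rintro ⟨hw, hws⟩
      have hws' : ψ₁.symm w ∈ s := hws
      refine ⟨ψ₀ (ψ₁.symm w), ⟨ψ₀.map_source (h₀ hws'), ?_⟩, ?_⟩
      · rw [mem_preimage, ψ₀.left_inv (h₀ hws')]; exact hws'
      · rw [transition_extChartAt (h₀ hws')]; exact ψ₁.right_inv hw
    · rintro ⟨u, ⟨hu, hus⟩, rfl⟩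
      have hus' : ψ₀.symm u ∈ s := hus
      refine ⟨ψ₁.map_source (h₁ hus'), ?_⟩
      change ψ₁.symm (ψ₁ (ψ₀.symm u)) ∈ s
      rw [ψ₁.left_inv (h₁ hus')]; exact hus'
  have hdiff : ∀ u ∈ S, DifferentiableAt ℝ (transition x₀ x₁) u := by
    intro u hu
    have := contDiffAt_transition (h₀ hu.2) (h₁ hu.2)
    rw [ψ₀.right_inv hu.1] at this
    exact this.differentiableAt (by simp)
  have hinj : InjOn (transition x₀ x₁) S := by
    intro u hu v hv huv
    have h := ψ₁.injOn (h₁ hu.2) (h₁ hv.2) huv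
    exact ψ₀.symm.injOn hu.1 hv.1 h
  rw [himg, lintegral_image_eq_lintegral_abs_det_fderiv_mul volume hSm
    (fun u hu => (hdiff u hu).hasFDerivAt.hasFDerivWithinAt) hinj]
  refine setLIntegral_congr_fun hSm fun u hu => ?_
  have h := det_metricCoeff_transition (h₀ hu.2) (h₁ hu.2)
  rw [ψ₀.right_inv hu.1] at h
  rw [volDensity, volDensity, ← ENNReal.ofReal_mul (abs_nonneg _), h,
    Real.sqrt_mul (sq_nonneg _), Real.sqrt_sq_eq_abs]
  rfl

variable [SecondCountableTopology M]

/-- In the domain of a chart the supremum of the chart volumes is the volume of that chart: all of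
them are dominated by the measure glued from countably many charts along a measurable partition. -/
lemma riemannianVolume_apply_of_subset_source {x₀ : M} {s : Set M} (hs : MeasurableSet s)
    (h₀ : s ⊆ (extChartAt (𝓡 n) x₀).source) :
    riemannianVolume n M s = chartVolume (n := n) x₀ s := by
  apply le_antisymm _ (Measure.le_iff'.1 (le_iSup (fun y : M => chartVolume (n := n) y) x₀) s)
  obtain ⟨c, hc, hcov⟩ := TopologicalSpace.countable_cover_nhds
    (f := fun x : M => (extChartAt (𝓡 n) x).source) fun x =>
      (isOpen_extChartAt_source x).mem_nhds (mem_extChartAt_source x)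
  have hne : c.Nonempty := by
    by_contra h
    rw [not_nonempty_iff_eq_empty.1 h] at hcov
    have h0 : x₀ ∈ (univ : Set M) := mem_univ x₀
    rw [← hcov] at h0
    simp at h0
  obtain ⟨y, rfl⟩ := hc.exists_eq_range hne
  -- a measure which agrees with `chartVolume (y k)` on the disjoint sets `D k`
  set D := disjointed fun k => (extChartAt (𝓡 n) (y k)).source with hD
  have hDm : ∀ k, MeasurableSet (D k) := fun k =>
    MeasurableSet.disjointed (fun k => (isOpen_extChartAt_source (y k)).measurableSet) k
  have hDU : ⋃ k, D k = univ := by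
    rw [hD, iUnion_disjointed, ← hcov, biUnion_range]
  have hDs : ∀ k, D k ⊆ (extChartAt (𝓡 n) (y k)).source := fun k => disjointed_subset _ k
  have hsplit : ∀ (μ : Measure M) {t : Set M}, MeasurableSet t → μ t = ∑' k, μ (t ∩ D k) := by
    intro μ t ht
    rw [← measure_iUnion (fun i j hij => (disjoint_disjointed _ hij).mono inter_subset_right
      inter_subset_right) fun k => ht.inter (hDm k), ← inter_iUnion, hDU, inter_univ]
  have hagree : ∀ (z : M) {t : Set M}, MeasurableSet t → t ⊆ (extChartAt (𝓡 n) z).source →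
      chartVolume (n := n) z t = ∑' k, chartVolume (n := n) (y k) (t ∩ D k) := by
    intro z t ht htz
    rw [hsplit _ ht]
    exact tsum_congr fun k => chartVolume_eq_of_subset (ht.inter (hDm k))
      (inter_subset_left.trans htz) (inter_subset_right.trans (hDs k))
  set ν : Measure M := Measure.sum fun k => (chartVolume (n := n) (y k)).restrict (D k) with hν
  have hνa : ∀ {t : Set M}, MeasurableSet t → ν t = ∑' k, chartVolume (n := n) (y k) (t ∩ D k) := by
    intro t ht
    rw [hν, Measure.sum_apply _ ht]
    exact tsum_congr fun k => Measure.restrict_apply ht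
  have hle : riemannianVolume n M ≤ ν := by
    refine iSup_le fun z => Measure.le_iff.2 fun t ht => ?_
    have htz := ht.inter (isOpen_extChartAt_source (I := 𝓡 n) z).measurableSet
    rw [← chartVolume_inter_source z ht, hagree z htz inter_subset_right, ← hνa htz]
    exact measure_mono inter_subset_left
  calc riemannianVolume n M s ≤ ν s := Measure.le_iff'.1 hle s
    _ = chartVolume (n := n) x₀ s := by rw [hνa hs, hagree x₀ hs h₀]

lemma riemannianVolume_restrict_source (x₀ : M) :
    (riemannianVolume n M).restrict (extChartAt (𝓡 n) x₀).source = chartVolume (n := n) x₀ := by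
  ext s hs
  rw [Measure.restrict_apply hs, riemannianVolume_apply_of_subset_source
    (hs.inter (isOpen_extChartAt_source x₀).measurableSet) inter_subset_right,
    chartVolume_inter_source x₀ hs]

variable [IsContMDiffRiemannianBundle (𝓡 n) ∞ (EuclideanSpace ℝ (Fin n))
      (fun x : M => TangentSpace (𝓡 n) x)]

omit [MeasurableSpace M] [BorelSpace M] [SecondCountableTopology M] in
lemma continuousOn_sqrt_det_metricCoeff (x₀ : M) :
    ContinuousOn (fun u => √(metricCoeff x₀ u).det) (extChartAt (𝓡 n) x₀).target :=
  (contDiffOn_det_metricCoeff x₀).continuousOn.sqrt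

lemma isLocallyFiniteMeasure_riemannianVolume :
    IsLocallyFiniteMeasure (riemannianVolume n M) := by
  refine ⟨fun x => ?_⟩
  set ψ := extChartAt (𝓡 n) x with hψ
  have htar := mem_extChartAt_target (I := 𝓡 n) x
  have hto := isOpen_extChartAt_target (I := 𝓡 n) x
  have hc := (continuousOn_sqrt_det_metricCoeff x).continuousAt (hto.mem_nhds htar)
  set C := √(metricCoeff x (ψ x)).det + 1
  have hev : ∀ᶠ u in 𝓝 (ψ x), u ∈ ψ.target ∧ √(metricCoeff x u).det < C :=
    (hto.eventually_mem htar).and (hc.eventually_lt_const (by simp [C, hψ]))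
  obtain ⟨r, hr, hball⟩ := Metric.eventually_nhds_iff_ball.1 hev
  set V := Metric.ball (ψ x) r
  have hVo : IsOpen (ψ.source ∩ ψ ⁻¹' V) :=
    (continuousOn_extChartAt x).isOpen_inter_preimage (isOpen_extChartAt_source x)
      Metric.isOpen_ball
  refine ⟨ψ.source ∩ ψ ⁻¹' V, hVo.mem_nhds ⟨mem_extChartAt_source x, Metric.mem_ball_self hr⟩, ?_⟩
  rw [riemannianVolume_apply_of_subset_source hVo.measurableSet inter_subset_left,
    chartVolume_apply x hVo.measurableSet]
  have hsub : ψ.target ∩ ψ.symm ⁻¹' (ψ.source ∩ ψ ⁻¹' V) ⊆ V := by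
    rintro u ⟨hu, _, hu2⟩
    rwa [mem_preimage, ψ.right_inv hu] at hu2
  calc ∫⁻ u in ψ.target ∩ ψ.symm ⁻¹' (ψ.source ∩ ψ ⁻¹' V), volDensity x u
      ≤ ∫⁻ u in V, volDensity x u := lintegral_mono_set hsub
    _ ≤ ∫⁻ _ in V, ENNReal.ofReal C := setLIntegral_mono' Metric.isOpen_ball.measurableSet
        fun u hu => ENNReal.ofReal_le_ofReal (hball u hu).2.le
    _ = ENNReal.ofReal C * volume V := setLIntegral_const _ _
    _ < ⊤ := ENNReal.mul_lt_top ENNReal.ofReal_lt_top measure_ball_lt_top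

lemma riemannianVolume_pos_of_isOpen {U : Set M} (hU : IsOpen U) (hne : U.Nonempty) :
    0 < riemannianVolume n M U := by
  obtain ⟨x, hx⟩ := hne
  set ψ := extChartAt (𝓡 n) x with hψ
  have hUo : IsOpen (U ∩ ψ.source) := hU.inter (isOpen_extChartAt_source x)
  refine lt_of_lt_of_le ?_ (measure_mono (inter_subset_left (s := U) (t := ψ.source)))
  rw [riemannianVolume_apply_of_subset_source hUo.measurableSet inter_subset_right,
    chartVolume_apply x hUo.measurableSet]
  have hSo := isOpen_target_inter_preimage (n := n) x hUo
  rw [pos_iff_ne_zero]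
  intro h0
  have hmeas : AEMeasurable (volDensity x)
      (volume.restrict (ψ.target ∩ ψ.symm ⁻¹' (U ∩ ψ.source))) :=
    (((continuousOn_sqrt_det_metricCoeff x).mono inter_subset_left).aemeasurable
      hSo.measurableSet).ennreal_ofReal
  rw [lintegral_eq_zero_iff' hmeas, EventuallyEq, ae_restrict_iff' hSo.measurableSet] at h0
  have hnull : volume (ψ.target ∩ ψ.symm ⁻¹' (U ∩ ψ.source)) = 0 := by
    refine measure_mono_null (fun u hu => ?_) h0
    intro h
    have h2 := h hu
    simp only [volDensity, Pi.zero_apply, ENNReal.ofReal_eq_zero] at h2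
    exact absurd (Real.sqrt_pos.2 (det_metricCoeff_pos hu.1)) (not_lt.2 h2)
  refine hSo.measure_ne_zero volume ⟨ψ x, mem_extChartAt_target x, ?_⟩ hnull
  rw [mem_preimage, ψ.left_inv (mem_extChartAt_source x)]
  exact ⟨hx, mem_extChartAt_source x⟩

/-- Integration in a chart of a function supported in the domain of the chart. -/
lemma integral_eq_integral_chart {x₀ : M} {G : M → ℝ} {F : E → ℝ} (hF : Continuous F)
    (hFc : HasCompactSupport F) (hG : ∀ x ∉ (extChartAt (𝓡 n) x₀).source, G x = 0)
    (hFG : ∀ u ∈ (extChartAt (𝓡 n) x₀).target,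
      F u = G ((extChartAt (𝓡 n) x₀).symm u) * √(metricCoeff x₀ u).det)
    (hF0 : ∀ u ∉ (extChartAt (𝓡 n) x₀).target, F u = 0) :
    Integrable G (riemannianVolume n M) ∧ ∫ x, G x ∂(riemannianVolume n M) = ∫ u, F u := by
  set ψ := extChartAt (𝓡 n) x₀ with hψ
  have hto : MeasurableSet ψ.target := (isOpen_extChartAt_target x₀).measurableSet
  have hso : MeasurableSet ψ.source := (isOpen_extChartAt_source x₀).measurableSet
  have hsupp : Function.support G ⊆ ψ.source := fun x hx => by
    by_contra h; exact hx (hG x h)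
  have hpos : ∀ u ∈ ψ.target, √(metricCoeff x₀ u).det ≠ 0 := fun u hu =>
    (Real.sqrt_pos.2 (det_metricCoeff_pos hu)).ne'
  have hGm : AEStronglyMeasurable G (chartVolume (n := n) x₀) := by
    rw [← riemannianVolume_restrict_source]
    refine ContinuousOn.aestronglyMeasurable ?_ hso
    have hc : ContinuousOn (fun x => F (ψ x) / √(metricCoeff x₀ (ψ x)).det) ψ.source := by
      refine ContinuousOn.div (hF.comp_continuousOn (continuousOn_extChartAt x₀)) ?_
        fun x hx => hpos _ (ψ.map_source hx)
      exact (continuousOn_sqrt_det_metricCoeff x₀).comp (continuousOn_extChartAt x₀)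
        fun x hx => ψ.map_source hx
    refine hc.congr fun x hx => ?_
    dsimp only
    rw [hFG _ (ψ.map_source hx), ψ.left_inv hx,
      mul_div_cancel_right₀ _ (hpos _ (ψ.map_source hx))]
  have hdm : AEMeasurable (fun u => ENNReal.ofReal (√(metricCoeff x₀ u).det))
      (volume.restrict ψ.target) :=
    ((continuousOn_sqrt_det_metricCoeff x₀).aemeasurable hto).ennreal_ofReal
  have hcongr : (fun u => (ENNReal.ofReal (√(metricCoeff x₀ u).det)).toReal • G (ψ.symm u))
      =ᵐ[volume.restrict ψ.target] F := by
    filter_upwards [ae_restrict_mem hto] with u hu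
    rw [ENNReal.toReal_ofReal (Real.sqrt_nonneg _), hFG u hu, smul_eq_mul, mul_comm]
  have hFsupp : Function.support F ⊆ ψ.target := fun u hu => by
    by_contra h; exact hu (hF0 u h)
  constructor
  · rw [← integrableOn_iff_integrable_of_support_subset hsupp, IntegrableOn,
      riemannianVolume_restrict_source, chartVolume,
      integrable_map_measure hGm (aemeasurable_extChartAt_symm x₀ _),
      integrable_withDensity_iff_integrable_smul₀' hdm (by simp)]
    exact ((hF.integrable_of_hasCompactSupport hFc).integrableOn).congr hcongr.symm
  · rw [← setIntegral_eq_integral_of_forall_compl_eq_zero (s := ψ.source) hG,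
      riemannianVolume_restrict_source, chartVolume,
      integral_map (aemeasurable_extChartAt_symm x₀ _) hGm,
      integral_withDensity_eq_integral_toReal_smul₀ hdm (by simp), integral_congr_ae hcongr,
      setIntegral_eq_integral_of_forall_compl_eq_zero hF0]

end Volume

/-! ### Differentials of functions -/

section Diff

variable {n : ℕ} {M : Type*} [TopologicalSpace M] [ChartedSpace (EuclideanSpace ℝ (Fin n)) M]

lemma diff_eq_zero_of_notMem_tsupport {h : M → ℝ} {x : M} (hx : x ∉ tsupport h) :
    diff (n := n) h x = 0 := by
  have h1 : h =ᶠ[𝓝 x] fun _ => 0 := notMem_tsupport_iff_eventuallyEq.1 hx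
  change mfderiv (𝓡 n) 𝓘(ℝ, ℝ) h x = 0
  rw [h1.mfderiv_eq, mfderiv_const]
  rfl

variable [IsManifold (𝓡 n) ∞ M]

lemma contDiffOn_comp_extChartAt_symm {h : M → ℝ} (hh : ContMDiff (𝓡 n) 𝓘(ℝ, ℝ) ∞ h) (x₀ : M) :
    ContDiffOn ℝ ∞ (h ∘ (extChartAt (𝓡 n) x₀).symm) (extChartAt (𝓡 n) x₀).target :=
  (hh.comp_contMDiffOn (contMDiffOn_extChartAt_symm (I := 𝓡 n) (n := ∞) x₀)).contDiffOn

lemma diff_sum {ι : Type*} {s : Finset ι} {f : ι → M → ℝ}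
    (hf : ∀ i ∈ s, ContMDiff (𝓡 n) 𝓘(ℝ, ℝ) ∞ (f i)) (x : M) (v : TangentSpace (𝓡 n) x) :
    diff (fun y => ∑ i ∈ s, f i y) x v = ∑ i ∈ s, diff (f i) x v := by
  have hmem := mem_extChartAt_source (I := 𝓡 n) x
  have hsum : ContMDiff (𝓡 n) 𝓘(ℝ, ℝ) ∞ fun y => ∑ i ∈ s, f i y := contMDiff_finsetSum hf
  have hd : ∀ i ∈ s, DifferentiableAt ℝ (f i ∘ (extChartAt (𝓡 n) x).symm)
      (extChartAt (𝓡 n) x x) := fun i hi =>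
    ((contDiffOn_comp_extChartAt_symm (hf i hi) x).contDiffAt
      ((isOpen_extChartAt_target x).mem_nhds (mem_extChartAt_target x))).differentiableAt (by simp)
  rw [diff_eq_fderiv hmem (hsum.mdifferentiableAt (by simp))]
  have : (fun y => ∑ i ∈ s, f i y) ∘ (extChartAt (𝓡 n) x).symm =
      fun u => ∑ i ∈ s, (f i ∘ (extChartAt (𝓡 n) x).symm) u := rfl
  rw [this, fderiv_fun_sum hd, sum_apply]
  exact Finset.sum_congr rfl fun i hi =>
    (diff_eq_fderiv hmem ((hf i hi).mdifferentiableAt (by simp)) v).symm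

lemma diff_sq {f : M → ℝ} (hf : ContMDiff (𝓡 n) 𝓘(ℝ, ℝ) ∞ f) (x : M)
    (v : TangentSpace (𝓡 n) x) :
    diff (fun y => f y ^ 2) x v = 2 * f x * diff f x v := by
  have hmem := mem_extChartAt_source (I := 𝓡 n) x
  have hd : DifferentiableAt ℝ (f ∘ (extChartAt (𝓡 n) x).symm) (extChartAt (𝓡 n) x x) :=
    ((contDiffOn_comp_extChartAt_symm hf x).contDiffAt
      ((isOpen_extChartAt_target x).mem_nhds (mem_extChartAt_target x))).differentiableAt (by simp)
  rw [diff_eq_fderiv hmem ((hf.pow 2).mdifferentiableAt (by simp)),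
    diff_eq_fderiv hmem (hf.mdifferentiableAt (by simp))]
  have : (fun y => f y ^ 2) ∘ (extChartAt (𝓡 n) x).symm =
      fun u => (f ∘ (extChartAt (𝓡 n) x).symm) u ^ 2 := rfl
  rw [this, (hd.hasFDerivAt.pow 2).fderiv, smul_apply, smul_eq_mul]
  simp

end Diff

/-! ### The divergence theorem -/

section Divergence

variable {m : ℕ} {M : Type*} [TopologicalSpace M] [ChartedSpace (EuclideanSpace ℝ (Fin (m + 1))) M]
  [IsManifold (𝓡 (m + 1)) ∞ M] [RiemannianBundle (fun x : M => TangentSpace (𝓡 (m + 1)) x)]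
  [IsContMDiffRiemannianBundle (𝓡 (m + 1)) ∞ (EuclideanSpace ℝ (Fin (m + 1)))
      (fun x : M => TangentSpace (𝓡 (m + 1)) x)]
  [T2Space M] [SecondCountableTopology M] [MeasurableSpace M] [BorelSpace M]
  {Ω : Set M} {𝓕 : Foliation m Ω} {η : Π x : M, TangentSpace (𝓡 (m + 1)) x}

namespace Foliation

/-- The divergence `div (h η) = h H + dh(η)` of a multiple of the unit normal field. -/
def divNormal (𝓕 : Foliation m Ω) (η : Π x : M, TangentSpace (𝓡 (m + 1)) x) (h : M → ℝ) (x : M) :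
    ℝ :=
  h x * 𝓕.meanCurvature η x + diff h x (η x)

omit [IsManifold (𝓡 (m + 1)) ∞ M]
  [IsContMDiffRiemannianBundle (𝓡 (m + 1)) ∞ (EuclideanSpace ℝ (Fin (m + 1)))
      (fun x : M => TangentSpace (𝓡 (m + 1)) x)]
  [T2Space M] [SecondCountableTopology M] [MeasurableSpace M] [BorelSpace M] in
lemma divNormal_eq_zero {h : M → ℝ} {x : M} (hx : x ∉ tsupport h) :
    𝓕.divNormal η h x = 0 := by
  rw [divNormal, diff_eq_zero_of_notMem_tsupport hx, image_eq_zero_of_notMem_tsupport hx]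
  simp

omit [T2Space M] in
/-- The divergence theorem for `h η`, when the support of `h` lies in the domain of one chart. -/
lemma IsUnitNormal.integral_divNormal_chart (hη : 𝓕.IsUnitNormal η) (hΩ : IsOpen Ω) {x₀ : M}
    {h : M → ℝ} (hh : ContMDiff (𝓡 (m + 1)) 𝓘(ℝ, ℝ) ∞ h) (hc : HasCompactSupport h)
    (hsΩ : tsupport h ⊆ Ω) (hs : tsupport h ⊆ (extChartAt (𝓡 (m + 1)) x₀).source) :
    Integrable (𝓕.divNormal η h) (riemannianVolume (m + 1) M) ∧
      ∫ x, 𝓕.divNormal η h x ∂(riemannianVolume (m + 1) M) = 0 := by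
  set ψ := extChartAt (𝓡 (m + 1)) x₀ with hψ
  set U := ψ.target ∩ ψ.symm ⁻¹' Ω with hU
  have hUo : IsOpen U := isOpen_target_inter_preimage x₀ hΩ
  have hK : IsCompact (ψ '' tsupport h) := hc.isCompact.image_of_continuousOn
    ((continuousOn_extChartAt x₀).mono hs)
  have hKU : ψ '' tsupport h ⊆ U := by
    rintro _ ⟨x, hx, rfl⟩
    refine ⟨ψ.map_source (hs hx), ?_⟩
    rw [mem_preimage, ψ.left_inv (hs hx)]
    exact hsΩ hx
  obtain ⟨F, hF, hFc, hF0, hFU, hFeq⟩ := integral_mul_coordDiv_add_fderiv_eq_zero hUo hK hKU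
    (((contDiffOn_comp_extChartAt_symm hh x₀).mono inter_subset_left).of_le (by norm_cast))
    (((contDiffOn_det_metricCoeff x₀).mono inter_subset_left).of_le (by norm_cast))
    (fun u hu => (hη.contDiffAt_coordField hΩ hu).contDiffWithinAt)
    (fun u hu => det_metricCoeff_pos hu.1)
    (fun u hu huK => image_eq_zero_of_notMem_tsupport (f := h) (x := ψ.symm u) fun hmem => huK
      ⟨ψ.symm u, hmem, ψ.right_inv hu.1⟩)
  rw [← hF0]
  refine integral_eq_integral_chart hF hFc (fun x hx => divNormal_eq_zero fun hx' => hx (hs hx'))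
    (fun u hu => ?_) fun u hu => hFU u fun h => hu h.1
  by_cases huΩ : ψ.symm u ∈ Ω
  · rw [hFeq u ⟨hu, huΩ⟩, divNormal, hη.meanCurvature_eq_coordDiv hΩ huΩ (ψ.map_target hu),
      diff_eq_fderiv (ψ.map_target hu) (hh.mdifferentiableAt (by simp)), ψ.right_inv hu]
    rfl
  · rw [hFU u fun h => huΩ h.2, divNormal_eq_zero fun hx' => huΩ (hsΩ hx'), zero_mul]

/-- The divergence theorem for `h η`, where `h` has compact support in `Ω`. -/
lemma IsUnitNormal.integral_divNormal (hη : 𝓕.IsUnitNormal η) (hΩ : IsOpen Ω)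
    {h : M → ℝ} (hh : ContMDiff (𝓡 (m + 1)) 𝓘(ℝ, ℝ) ∞ h) (hc : HasCompactSupport h)
    (hsΩ : tsupport h ⊆ Ω) :
    Integrable (𝓕.divNormal η h) (riemannianVolume (m + 1) M) ∧
      ∫ x, 𝓕.divNormal η h x ∂(riemannianVolume (m + 1) M) = 0 := by
  have : LocallyCompactSpace M := Manifold.locallyCompact_of_finiteDimensional (𝓡 (m + 1))
  obtain ⟨ρ, hρ⟩ := SmoothPartitionOfUnity.exists_isSubordinate_chartAt_source (𝓡 (m + 1)) M
  have hfin := ρ.locallyFinite.finite_nonempty_inter_compact hc.isCompact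
  set S := hfin.toFinset with hS
  have hρh : ∀ i, ContMDiff (𝓡 (m + 1)) 𝓘(ℝ, ℝ) ∞ fun x => ρ i x * h x := fun i =>
    (ρ i).contMDiff.mul hh
  have hsum : h = fun x => ∑ i ∈ S, ρ i x * h x := by
    funext x
    by_cases hx : x ∈ tsupport h
    · have h1 : ∑ i ∈ S, ρ i x = 1 := by
        refine ρ.sum_finsupport' x (mem_univ x) fun i hi => ?_
        rw [hS, Set.Finite.mem_toFinset]
        exact ⟨x, (ρ.mem_finsupport x).1 hi, hx⟩
      rw [← Finset.sum_mul, h1, one_mul]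
    · simp [image_eq_zero_of_notMem_tsupport hx]
  have hdiv : 𝓕.divNormal η h = fun x => ∑ i ∈ S, 𝓕.divNormal η (fun y => ρ i y * h y) x := by
    funext x
    conv_lhs => rw [hsum]
    simp only [divNormal]
    rw [diff_sum (fun i _ => hρh i), Finset.sum_add_distrib, Finset.sum_mul]
  have hloc : ∀ i, Integrable (𝓕.divNormal η fun y => ρ i y * h y) (riemannianVolume (m + 1) M) ∧
      ∫ x, 𝓕.divNormal η (fun y => ρ i y * h y) x ∂(riemannianVolume (m + 1) M) = 0 := by
    intro i
    refine hη.integral_divNormal_chart hΩ (x₀ := i) (hρh i) (hc.mul_left)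
      ((tsupport_mul_subset_right).trans hsΩ) ((tsupport_mul_subset_left).trans ?_)
    rw [extChartAt_source]
    exact hρ i
  rw [hdiv]
  exact ⟨integrable_finsetSum _ fun i _ => (hloc i).1, by
    rw [integral_finsetSum _ fun i _ => (hloc i).1]
    exact Finset.sum_eq_zero fun i _ => (hloc i).2⟩

end Foliation

end Divergence

/-! ### Limits in the space of square integrable functions -/

section LpLimit

variable {α : Type*} [MeasurableSpace α] {μ : Measure α}

lemma eLpNorm_two_eq_lintegral_rpow (f : α → ℝ) :
    eLpNorm f 2 μ = (∫⁻ x, ‖f x‖ₑ ^ 2 ∂μ) ^ (1 / 2 : ℝ) := by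
  rw [eLpNorm_eq_lintegral_rpow_enorm_toReal (by norm_num) (by norm_num)]
  simp

lemma tendsto_eLpNorm_two {f : ℕ → α → ℝ}
    (h : Tendsto (fun k => ∫⁻ x, ‖f k x‖ₑ ^ 2 ∂μ) atTop (𝓝 0)) :
    Tendsto (fun k => eLpNorm (f k) 2 μ) atTop (𝓝 0) := by
  simp only [eLpNorm_two_eq_lintegral_rpow]
  have := ((ENNReal.continuous_rpow_const (y := 1 / 2)).tendsto 0).comp h
  simpa [Function.comp_def] using this

/-- An inequality between `L²` seminorms passes to the limit. -/
lemma mul_eLpNorm_le_of_tendsto {f g : α → ℝ} {φ γ δ : ℕ → α → ℝ} {a : ℝ≥0∞} (ha : a ≠ ⊤)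
    (hf : AEStronglyMeasurable f μ) (hg : AEStronglyMeasurable g μ)
    (hφ : ∀ k, AEStronglyMeasurable (φ k) μ) (hδ : ∀ k, AEStronglyMeasurable (δ k) μ)
    (hφf : Tendsto (fun k => eLpNorm (φ k - f) 2 μ) atTop (𝓝 0))
    (hδ0 : Tendsto (fun k => eLpNorm (δ k) 2 μ) atTop (𝓝 0))
    (hγ : ∀ k x, ‖γ k x‖ ≤ g x + δ k x)
    (h : ∀ k, a * eLpNorm (φ k) 2 μ ≤ eLpNorm (γ k) 2 μ) :
    a * eLpNorm f 2 μ ≤ eLpNorm g 2 μ := by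
  have hlim : Tendsto (fun k => eLpNorm g 2 μ + eLpNorm (δ k) 2 μ + a * eLpNorm (φ k - f) 2 μ)
      atTop (𝓝 (eLpNorm g 2 μ + 0 + a * 0)) :=
    (tendsto_const_nhds.add hδ0).add (ENNReal.Tendsto.const_mul hφf (Or.inr ha))
  rw [mul_zero, add_zero, add_zero] at hlim
  refine ge_of_tendsto' hlim fun k => ?_
  have h1 : eLpNorm f 2 μ ≤ eLpNorm (φ k) 2 μ + eLpNorm (φ k - f) 2 μ := by
    have := eLpNorm_sub_le (p := 2) (hφ k) ((hφ k).sub hf) (by norm_num)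
    rwa [sub_sub_cancel] at this
  have h2 : eLpNorm (γ k) 2 μ ≤ eLpNorm g 2 μ + eLpNorm (δ k) 2 μ :=
    (eLpNorm_mono_real (hγ k)).trans (eLpNorm_add_le hg (hδ k) (by norm_num))
  calc a * eLpNorm f 2 μ ≤ a * (eLpNorm (φ k) 2 μ + eLpNorm (φ k - f) 2 μ) := by gcongr
    _ = a * eLpNorm (φ k) 2 μ + a * eLpNorm (φ k - f) 2 μ := mul_add _ _ _
    _ ≤ _ := by gcongr; exact (h k).trans h2

lemma integral_sq_eq_toReal_eLpNorm_sq {f : α → ℝ} (hf : AEStronglyMeasurable f μ) :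
    ∫ x, f x ^ 2 ∂μ = (eLpNorm f 2 μ).toReal ^ 2 := by
  rw [integral_eq_lintegral_of_nonneg_ae (Eventually.of_forall fun x => sq_nonneg _) (hf.pow 2),
    ← ENNReal.toReal_pow, eLpNorm_two_eq_lintegral_rpow, ← ENNReal.rpow_natCast,
    ← ENNReal.rpow_mul]
  norm_num
  congr 1
  refine lintegral_congr fun x => ?_
  rw [← ofReal_norm, ← ENNReal.ofReal_pow (norm_nonneg _), Real.norm_eq_abs, sq_abs]

end LpLimit

/-! ### Gradients -/

section Gradient

variable {n : ℕ} {M : Type*} [TopologicalSpace M] [ChartedSpace (EuclideanSpace ℝ (Fin n)) M]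
  [IsManifold (𝓡 n) ∞ M] [RiemannianBundle (fun x : M => TangentSpace (𝓡 n) x)]

omit [IsManifold (𝓡 n) ∞ M] in
lemma inner_grad (f : M → ℝ) (x : M) (v : TangentSpace (𝓡 n) x) :
    inner ℝ (grad f x) v = diff f x v := by
  have : CompleteSpace (TangentSpace (𝓡 n) x) := FiniteDimensional.complete ℝ _
  exact InnerProductSpace.toDual_symm_apply

omit [IsManifold (𝓡 n) ∞ M] in
lemma grad_eq_zero_of_notMem_tsupport {f : M → ℝ} {x : M} (hx : x ∉ tsupport f) :
    grad (n := n) f x = 0 := by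
  refine ext_inner_right ℝ fun v => ?_
  rw [inner_grad, diff_eq_zero_of_notMem_tsupport hx, inner_zero_left]
  rfl

lemma norm_eq_sqrt_sum {x₀ x : M} (hx : x ∈ (extChartAt (𝓡 n) x₀).source)
    (v : TangentSpace (𝓡 n) x) :
    ‖v‖ = √(∑ i, ∑ j, metricCoeff x₀ (extChartAt (𝓡 n) x₀ x) i j *
      toCoord x₀ x v i * toCoord x₀ x v j) := by
  rw [← inner_eq_sum_metricCoeff hx, real_inner_self_eq_norm_sq, Real.sqrt_sq (norm_nonneg _)]

variable [IsContMDiffRiemannianBundle (𝓡 n) ∞ (EuclideanSpace ℝ (Fin n))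
      (fun x : M => TangentSpace (𝓡 n) x)]

lemma continuousOn_metricCoeff_comp (x₀ : M) (i j : Fin n) :
    ContinuousOn (fun x => metricCoeff x₀ (extChartAt (𝓡 n) x₀ x) i j)
      (extChartAt (𝓡 n) x₀).source :=
  (contDiffOn_metricCoeff x₀ i j).continuousOn.comp (continuousOn_extChartAt x₀)
    fun _ hx => (extChartAt (𝓡 n) x₀).map_source hx

/-- In coordinates, `(∇f)ⁱ = ∑ⱼ gⁱʲ ∂ⱼ f`. -/
lemma continuousOn_toCoord_grad {f : M → ℝ} (hf : ContMDiff (𝓡 n) 𝓘(ℝ, ℝ) ∞ f) (x₀ : M) :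
    ContinuousOn (fun x => toCoord (n := n) x₀ x (grad f x)) (extChartAt (𝓡 n) x₀).source := by
  set ψ := extChartAt (𝓡 n) x₀ with hψ
  have hmap : MapsTo ψ ψ.source ψ.target := fun x hx => ψ.map_source hx
  have hcomp : ∀ i x, x ∈ ψ.source → toCoord (n := n) x₀ x (grad f x) i =
      ∑ j, (metricCoeff x₀ (ψ x))⁻¹ i j *
      fderiv ℝ (f ∘ ψ.symm) (ψ x) (EuclideanSpace.single j 1) := fun i x hx =>
    toCoord_eq_sum_inv hx _ _ (fun w => by
      rw [inner_grad, diff_eq_fderiv hx (hf.mdifferentiableAt (by simp))]) i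
  have hdf : ContinuousOn (fderiv ℝ (f ∘ ψ.symm)) ψ.target :=
    (contDiffOn_comp_extChartAt_symm hf x₀).continuousOn_fderiv_of_isOpen
      (isOpen_extChartAt_target x₀) (by simp)
  have h2 : ContinuousOn (fun x => (WithLp.ofLp (toCoord (n := n) x₀ x (grad f x)) : Fin n → ℝ))
      ψ.source := by
    rw [continuousOn_pi]
    intro i
    refine ContinuousOn.congr ?_ (hcomp i)
    refine continuousOn_finsetSum _ fun j _ => ContinuousOn.mul ?_ ?_
    · exact (contDiffOn_metricCoeff_inv x₀ i j).continuousOn.comp (continuousOn_extChartAt x₀) hmap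
    · exact (hdf.comp (continuousOn_extChartAt x₀) hmap).clm_apply continuousOn_const
  exact (PiLp.continuous_toLp 2 _).comp_continuousOn h2

lemma continuous_norm_grad {f : M → ℝ} (hf : ContMDiff (𝓡 n) 𝓘(ℝ, ℝ) ∞ f) :
    Continuous fun x => ‖grad (n := n) f x‖ := by
  rw [continuous_iff_continuousAt]
  intro x
  have hs := (isOpen_extChartAt_source (I := 𝓡 n) x).mem_nhds (mem_extChartAt_source x)
  refine ContinuousOn.continuousAt (ContinuousOn.congr ?_ fun y hy => norm_eq_sqrt_sum hy _) hs
  have hc := continuousOn_toCoord_grad hf x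
  have hci : ∀ i, ContinuousOn (fun y => toCoord (n := n) x y (grad f y) i)
      (extChartAt (𝓡 n) x).source := fun i => (EuclideanSpace.proj (𝕜 := ℝ) i).continuous.comp_continuousOn hc
  exact (continuousOn_finsetSum _ fun i _ => continuousOn_finsetSum _ fun j _ =>
    ((continuousOn_metricCoeff_comp x i j).mul (hci i)).mul (hci j)).sqrt

variable [MeasurableSpace M] [BorelSpace M]

lemma isMeasurableField_grad {f : M → ℝ} (hf : ContMDiff (𝓡 n) 𝓘(ℝ, ℝ) ∞ f) {Ω : Set M}
    (hΩ : IsOpen Ω) : IsMeasurableField n Ω (grad f) := by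
  intro x₀
  exact ((continuousOn_toCoord_grad hf x₀).mono inter_subset_right).aestronglyMeasurable
    (hΩ.inter (isOpen_extChartAt_source x₀)).measurableSet

omit [IsManifold (𝓡 n) ∞ M] [IsContMDiffRiemannianBundle (𝓡 n) ∞ (EuclideanSpace ℝ (Fin n))
      (fun x : M => TangentSpace (𝓡 n) x)] [BorelSpace M] in
lemma IsMeasurableField.sub {Ω : Set M} {G G' : Π x : M, TangentSpace (𝓡 n) x}
    (hG : IsMeasurableField n Ω G) (hG' : IsMeasurableField n Ω G') :
    IsMeasurableField n Ω (fun x => G x - G' x) := by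
  intro x₀
  refine ((hG x₀).sub (hG' x₀)).congr (Eventually.of_forall fun x => ?_)
  exact (map_sub (toCoord x₀ x) (G x) (G' x)).symm

/-- The norm is measurable in each chart, and countably many charts cover `M`. -/
lemma IsMeasurableField.aestronglyMeasurable_norm [SecondCountableTopology M] {Ω : Set M}
    (hΩ : IsOpen Ω) {G : Π x : M, TangentSpace (𝓡 n) x} (hG : IsMeasurableField n Ω G) :
    AEStronglyMeasurable (fun x => ‖G x‖) ((riemannianVolume n M).restrict Ω) := by
  obtain ⟨c, hc, hcov⟩ := TopologicalSpace.countable_cover_nhds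
    (f := fun x : M => (extChartAt (𝓡 n) x).source) fun x =>
      (isOpen_extChartAt_source x).mem_nhds (mem_extChartAt_source x)
  have : Countable c := hc.to_subtype
  have hΩc : Ω = ⋃ x : c, Ω ∩ (extChartAt (𝓡 n) (x : M)).source := by
    rw [← inter_iUnion, ← biUnion_eq_iUnion c fun x _ => (extChartAt (𝓡 n) x).source, hcov,
      inter_univ]
  rw [hΩc, aestronglyMeasurable_iUnion_iff]
  rintro ⟨x₀, -⟩
  have hm := (hΩ.inter (isOpen_extChartAt_source (I := 𝓡 n) x₀)).measurableSet
  have h1 : AEStronglyMeasurable (fun x => toCoord x₀ x (G x))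
    ((riemannianVolume n M).restrict (Ω ∩ (extChartAt (𝓡 n) x₀).source)) := hG x₀
  have hi : ∀ i, AEStronglyMeasurable (fun x => toCoord x₀ x (G x) i)
    ((riemannianVolume n M).restrict (Ω ∩ (extChartAt (𝓡 n) x₀).source)) := fun i =>
    (EuclideanSpace.proj (𝕜 := ℝ) i).continuous.comp_aestronglyMeasurable h1
  have hsum : AEStronglyMeasurable (fun x => √(∑ i, ∑ j,
      metricCoeff x₀ (extChartAt (𝓡 n) x₀ x) i j * toCoord x₀ x (G x) i * toCoord x₀ x (G x) j))
      ((riemannianVolume n M).restrict (Ω ∩ (extChartAt (𝓡 n) x₀).source)) := by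
    refine Real.continuous_sqrt.comp_aestronglyMeasurable
      (Finset.aestronglyMeasurable_fun_sum _ fun i _ =>
        Finset.aestronglyMeasurable_fun_sum _ fun j _ => ((?_ : AEStronglyMeasurable _ _).mul
          (hi i)).mul (hi j))
    exact ((continuousOn_metricCoeff_comp x₀ i j).mono inter_subset_right).aestronglyMeasurable hm
  refine hsum.congr ?_
  filter_upwards [ae_restrict_mem hm] with x hx
  exact (norm_eq_sqrt_sum hx.2 _).symm

variable [SecondCountableTopology M] [T2Space M]

lemma IsTestFunction.integrable_sq {Ω : Set M} {φ : M → ℝ} (hφ : IsTestFunction n Ω φ) :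
    Integrable (fun x => φ x ^ 2) (riemannianVolume n M) := by
  have := isLocallyFiniteMeasure_riemannianVolume (n := n) (M := M)
  refine (hφ.1.continuous.pow 2).integrable_of_hasCompactSupport ?_
  refine HasCompactSupport.intro hφ.2.1.isCompact fun x hx => ?_
  rw [Pi.pow_apply, image_eq_zero_of_notMem_tsupport hx, zero_pow two_ne_zero]

lemma IsTestFunction.integrable_norm_grad_sq {Ω : Set M} {φ : M → ℝ}
    (hφ : IsTestFunction n Ω φ) :
    Integrable (fun x => ‖grad (n := n) φ x‖ ^ 2) (riemannianVolume n M) := by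
  have := isLocallyFiniteMeasure_riemannianVolume (n := n) (M := M)
  refine ((continuous_norm_grad hφ.1).pow 2).integrable_of_hasCompactSupport ?_
  refine HasCompactSupport.intro hφ.2.1.isCompact fun x hx => ?_
  rw [Pi.pow_apply, grad_eq_zero_of_notMem_tsupport hx, norm_zero, zero_pow two_ne_zero]

end Gradient

/-! ### From test functions to the Sobolev space -/

section Sobolev

variable {n : ℕ} {M : Type*} [TopologicalSpace M] [ChartedSpace (EuclideanSpace ℝ (Fin n)) M]
  [IsManifold (𝓡 n) ∞ M] [RiemannianBundle (fun x : M => TangentSpace (𝓡 n) x)]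
  [IsContMDiffRiemannianBundle (𝓡 n) ∞ (EuclideanSpace ℝ (Fin n))
      (fun x : M => TangentSpace (𝓡 n) x)]
  [T2Space M] [SecondCountableTopology M] [MeasurableSpace M] [BorelSpace M] {Ω : Set M}

/-- An inequality `a² ∫ φ² ≤ ∫ |∇φ|²` for test functions extends to `H₀¹(Ω)`. -/
lemma le_div_of_isH01 (hΩ : IsOpen Ω) {a : ℝ} (ha : 0 ≤ a)
    (htest : ∀ φ : M → ℝ, IsTestFunction n Ω φ →
      a ^ 2 * ∫ x, φ x ^ 2 ∂(riemannianVolume n M) ≤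
        ∫ x, ‖grad (n := n) φ x‖ ^ 2 ∂(riemannianVolume n M))
    {f : M → ℝ} {G : Π x : M, TangentSpace (𝓡 n) x} (hfG : IsH01 Ω f G)
    (hf0 : ¬ (f =ᵐ[(riemannianVolume n M).restrict Ω] 0)) :
    a ^ 2 ≤ (∫ x in Ω, ‖G x‖ ^ 2 ∂(riemannianVolume n M)) /
      (∫ x in Ω, f x ^ 2 ∂(riemannianVolume n M)) := by
  obtain ⟨hf, hG, φ, hφ, hφf, hφG⟩ := hfG
  set μ := (riemannianVolume n M).restrict Ω with hμ
  have hφm : ∀ k, AEStronglyMeasurable (φ k) μ := fun k =>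
    (hφ k).1.continuous.aestronglyMeasurable
  have hγm : ∀ k, AEStronglyMeasurable (fun x => ‖grad (n := n) (φ k) x‖) μ := fun k =>
    (continuous_norm_grad (hφ k).1).aestronglyMeasurable
  have hgm : AEStronglyMeasurable (fun x => ‖G x‖) μ := hG.aestronglyMeasurable_norm hΩ
  have hδm : ∀ k, AEStronglyMeasurable (fun x => ‖grad (φ k) x - G x‖) μ := fun k =>
    ((isMeasurableField_grad (hφ k).1 hΩ).sub hG).aestronglyMeasurable_norm hΩ
  have hφ2 : ∀ k, MemLp (φ k) 2 μ := fun k =>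
    (memLp_two_iff_integrable_sq (hφm k)).2 (hφ k).integrable_sq.restrict
  have hγ2 : ∀ k, MemLp (fun x => ‖grad (n := n) (φ k) x‖) 2 μ := fun k =>
    (memLp_two_iff_integrable_sq (hγm k)).2 (hφ k).integrable_norm_grad_sq.restrict
  have hlimf : Tendsto (fun k => eLpNorm (φ k - f) 2 μ) atTop (𝓝 0) := tendsto_eLpNorm_two hφf
  have hlimG : Tendsto (fun k => eLpNorm (fun x => ‖grad (φ k) x - G x‖) 2 μ) atTop (𝓝 0) :=
    tendsto_eLpNorm_two (by simpa only [enorm_norm] using hφG)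
  -- `f` and `|G|` are square integrable, as limits of square integrable functions
  have hf2 : MemLp f 2 μ := by
    obtain ⟨k, hk⟩ := (hlimf.eventually (gt_mem_nhds ENNReal.zero_lt_top)).exists
    have h := (hφ2 k).sub ⟨(hφm k).sub hf, hk⟩
    rwa [sub_sub_cancel] at h
  have hg2 : MemLp (fun x => ‖G x‖) 2 μ := by
    obtain ⟨k, hk⟩ := (hlimG.eventually (gt_mem_nhds ENNReal.zero_lt_top)).exists
    have hδ2 : MemLp (fun x => ‖grad (φ k) x - G x‖) 2 μ := ⟨hδm k, hk⟩
    refine ((hγ2 k).add hδ2).mono' hgm (Eventually.of_forall fun x => ?_)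
    rw [Real.norm_eq_abs, abs_norm, Pi.add_apply]
    have := norm_sub_le (grad (φ k) x) (grad (φ k) x - G x)
    rwa [sub_sub_cancel] at this
  have hk : ∀ k, ENNReal.ofReal a * eLpNorm (φ k) 2 μ ≤
      eLpNorm (fun x => ‖grad (n := n) (φ k) x‖) 2 μ := by
    intro k
    have h1 := htest (φ k) (hφ k)
    have hout : ∀ x ∉ Ω, x ∉ tsupport (φ k) := fun x hx h => hx ((hφ k).2.2 h)
    have e1 : ∫ x in Ω, φ k x ^ 2 ∂(riemannianVolume n M) =
        ∫ x, φ k x ^ 2 ∂(riemannianVolume n M) :=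
      setIntegral_eq_integral_of_forall_compl_eq_zero fun x hx => by
        rw [image_eq_zero_of_notMem_tsupport (hout x hx), zero_pow two_ne_zero]
    have e2 : ∫ x in Ω, ‖grad (n := n) (φ k) x‖ ^ 2 ∂(riemannianVolume n M) =
        ∫ x, ‖grad (n := n) (φ k) x‖ ^ 2 ∂(riemannianVolume n M) :=
      setIntegral_eq_integral_of_forall_compl_eq_zero fun x hx => by
        rw [grad_eq_zero_of_notMem_tsupport (hout x hx), norm_zero, zero_pow two_ne_zero]
    rw [← e1, ← e2, integral_sq_eq_toReal_eLpNorm_sq (hφm k),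
      integral_sq_eq_toReal_eLpNorm_sq (hγm k), ← mul_pow] at h1
    have h2 := (pow_le_pow_iff_left₀ (by positivity) (by positivity) two_ne_zero).1 h1
    rw [← ENNReal.ofReal_toReal (hφ2 k).2.ne, ← ENNReal.ofReal_mul ha,
      ← ENNReal.ofReal_toReal (hγ2 k).2.ne]
    exact ENNReal.ofReal_le_ofReal h2
  have hfin := mul_eLpNorm_le_of_tendsto ENNReal.ofReal_ne_top hf hgm hφm hδm hlimf hlimG
    (γ := fun k x => ‖grad (n := n) (φ k) x‖) (fun k x => by
      rw [Real.norm_eq_abs, abs_norm]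
      have := norm_add_le (G x) (grad (φ k) x - G x)
      rwa [add_sub_cancel] at this) hk
  have hreal : a * (eLpNorm f 2 μ).toReal ≤ (eLpNorm (fun x => ‖G x‖) 2 μ).toReal := by
    have := ENNReal.toReal_mono hg2.2.ne hfin
    rwa [ENNReal.toReal_mul, ENNReal.toReal_ofReal ha] at this
  have hpos : 0 < (eLpNorm f 2 μ).toReal := by
    refine ENNReal.toReal_pos ?_ hf2.2.ne
    rwa [Ne, eLpNorm_eq_zero_iff hf two_ne_zero]
  rw [integral_sq_eq_toReal_eLpNorm_sq hf, integral_sq_eq_toReal_eLpNorm_sq hgm,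
    le_div_iff₀ (by positivity), ← mul_pow]
  exact pow_le_pow_left₀ (by positivity) hreal 2

/-- A nonempty open set carries a test function which does not vanish almost everywhere. -/
lemma exists_isH01_ne_zero (hΩ : IsOpen Ω) (hne : Ω.Nonempty) :
    ∃ (f : M → ℝ) (G : Π x : M, TangentSpace (𝓡 n) x), IsH01 Ω f G ∧
      ¬ (f =ᵐ[(riemannianVolume n M).restrict Ω] 0) := by
  obtain ⟨x, hx⟩ := hne
  obtain ⟨b, -, hb⟩ := (SmoothBumpFunction.nhds_basis_tsupport (I := 𝓡 n) x).mem_iff.1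
    (hΩ.mem_nhds hx)
  have htest : IsTestFunction n Ω b := ⟨b.contMDiff, b.hasCompactSupport, hb⟩
  refine ⟨b, grad b, ⟨b.continuous.aestronglyMeasurable, isMeasurableField_grad b.contMDiff hΩ,
    fun _ => b, fun _ => htest, by simp, by simp⟩, fun h0 => ?_⟩
  rw [EventuallyEq, ae_restrict_iff' hΩ.measurableSet] at h0
  have hU : IsOpen (Ω ∩ Function.support b) := hΩ.inter b.continuous.isOpen_support
  have hpos := riemannianVolume_pos_of_isOpen (n := n) hU ⟨x, hx, by simp⟩
  refine hpos.ne' (measure_mono_null (fun y hy => ?_) h0)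
  intro h
  exact hy.2 (h hy.1)

end Sobolev

/-! ### The inequality for test functions -/

section Barta

variable {m : ℕ} {M : Type*} [TopologicalSpace M] [ChartedSpace (EuclideanSpace ℝ (Fin (m + 1))) M]
  [IsManifold (𝓡 (m + 1)) ∞ M] [RiemannianBundle (fun x : M => TangentSpace (𝓡 (m + 1)) x)]
  [IsContMDiffRiemannianBundle (𝓡 (m + 1)) ∞ (EuclideanSpace ℝ (Fin (m + 1)))
      (fun x : M => TangentSpace (𝓡 (m + 1)) x)]
  {Ω : Set M} {𝓕 : Foliation m Ω} {η : Π x : M, TangentSpace (𝓡 (m + 1)) x}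

namespace Foliation

/-- If the mean curvature is bounded away from zero on a connected set, its sign is constant. -/
lemma IsUnitNormal.exists_sign (hη : 𝓕.IsUnitNormal η) (hΩ : IsOpen Ω) (hconn : IsPreconnected Ω)
    {c : ℝ} (hc : 0 < c) (hH : ∀ x ∈ Ω, c ≤ |𝓕.meanCurvature η x|) :
    ∃ ε : ℝ, |ε| = 1 ∧ ∀ x ∈ Ω, c ≤ ε * 𝓕.meanCurvature η x := by
  by_cases hpos : ∀ x ∈ Ω, 0 < 𝓕.meanCurvature η x
  · exact ⟨1, abs_one, fun x hx => by simpa [abs_of_pos (hpos x hx)] using hH x hx⟩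
  · push Not at hpos
    obtain ⟨y, hy, hy0⟩ := hpos
    refine ⟨-1, by simp, fun x hx => ?_⟩
    have hneg : 𝓕.meanCurvature η x ≤ 0 := by
      by_contra! h
      obtain ⟨z, hz, hz0⟩ := hconn.intermediate_value hy hx (hη.continuousOn_meanCurvature hΩ)
        ⟨hy0, h.le⟩
      have := hH z hz
      rw [hz0, abs_zero] at this
      exact absurd this (not_le.2 hc)
    have := hH x hx
    rw [abs_of_nonpos hneg] at this
    simpa using this

variable [T2Space M] [SecondCountableTopology M] [MeasurableSpace M] [BorelSpace M]

/-- The inequality `(c / 2)² ∫ φ² ≤ ∫ |∇φ|²` for test functions, when `|H| ≥ c > 0`: integrate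
`± div (φ² η) ≥ c φ² - 2 |φ| |∇φ| ≥ (c / 2) φ² - (2 / c) |∇φ|²`. -/
lemma IsUnitNormal.sq_mul_integral_le (hη : 𝓕.IsUnitNormal η) (hΩ : IsOpen Ω)
    (hconn : IsPreconnected Ω) {c : ℝ} (hc : 0 < c)
    (hH : ∀ x ∈ Ω, c ≤ |𝓕.meanCurvature η x|) {φ : M → ℝ} (hφ : IsTestFunction (m + 1) Ω φ) :
    (c / 2) ^ 2 * ∫ x, φ x ^ 2 ∂(riemannianVolume (m + 1) M) ≤
      ∫ x, ‖grad (n := m + 1) φ x‖ ^ 2 ∂(riemannianVolume (m + 1) M) := by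
  obtain ⟨ε, hε, hεH⟩ := hη.exists_sign hΩ hconn hc hH
  have hsub : tsupport (fun x => φ x ^ 2) ⊆ tsupport φ :=
    closure_mono fun x hx h => hx (by simp [h])
  obtain ⟨hint, hzero⟩ := hη.integral_divNormal hΩ (hφ.1.pow 2)
    (HasCompactSupport.intro hφ.2.1.isCompact fun x hx => by
      rw [image_eq_zero_of_notMem_tsupport hx, zero_pow two_ne_zero])
    (hsub.trans hφ.2.2)
  have hpt : ∀ x, c / 2 * φ x ^ 2 - 2 / c * ‖grad (n := m + 1) φ x‖ ^ 2 ≤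
      ε * 𝓕.divNormal η (fun y => φ y ^ 2) x := by
    intro x
    by_cases hx : x ∈ tsupport φ
    · have hxΩ := hφ.2.2 hx
      have hH' := hεH x hxΩ
      have hcs : |ε * (φ x * diff φ x (η x))| ≤ |φ x| * ‖grad (n := m + 1) φ x‖ := by
        rw [abs_mul, hε, one_mul, abs_mul, ← inner_grad]
        gcongr
        simpa [hη.norm_eq_one x hxΩ] using abs_real_inner_le_norm (grad φ x) (η x)
      have hlow := (abs_le.1 hcs).1
      have hsq : 2 * (|φ x| * ‖grad (n := m + 1) φ x‖) ≤
          c / 2 * φ x ^ 2 + 2 / c * ‖grad (n := m + 1) φ x‖ ^ 2 := by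
        have h2 : c / 2 * φ x ^ 2 + 2 / c * ‖grad (n := m + 1) φ x‖ ^ 2
            - 2 * (|φ x| * ‖grad (n := m + 1) φ x‖)
            = (c * |φ x| - 2 * ‖grad (n := m + 1) φ x‖) ^ 2 / (2 * c) := by
          rw [← sq_abs (φ x)]; field_simp; ring
        have h3 : 0 ≤ (c * |φ x| - 2 * ‖grad (n := m + 1) φ x‖) ^ 2 / (2 * c) := by positivity
        linarith
      rw [divNormal, diff_sq hφ.1]
      have h4 : c * φ x ^ 2 ≤ ε * 𝓕.meanCurvature η x * φ x ^ 2 :=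
        mul_le_mul_of_nonneg_right hH' (sq_nonneg _)
      nlinarith
    · rw [divNormal_eq_zero fun h => hx (hsub h), image_eq_zero_of_notMem_tsupport hx,
        grad_eq_zero_of_notMem_tsupport hx]
      simp
  have hi1 := hφ.integrable_sq.const_mul (c / 2)
  have hi2 := hφ.integrable_norm_grad_sq.const_mul (2 / c)
  have hmono := integral_mono (hi1.sub hi2) (hint.const_mul ε) hpt
  rw [integral_sub' hi1 hi2, integral_const_mul, integral_const_mul, integral_const_mul] at hmono
  have hzero' : ∫ x, 𝓕.divNormal η (fun y => φ y ^ 2) x ∂(riemannianVolume (m + 1) M) = 0 := hzero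
  rw [hzero', mul_zero] at hmono
  -- `c/2 ∫ φ² ≤ 2/c ∫ |∇φ|²`, to be multiplied by `c/2`
  have h5 := mul_le_mul_of_nonneg_left (sub_nonpos.1 hmono) (show (0 : ℝ) ≤ c / 2 by positivity)
  calc (c / 2) ^ 2 * ∫ x, φ x ^ 2 ∂(riemannianVolume (m + 1) M)
      = c / 2 * (c / 2 * ∫ x, φ x ^ 2 ∂(riemannianVolume (m + 1) M)) := by ring
    _ ≤ _ := h5
    _ = _ := by field_simp

end Foliation

end Barta

end RiemFol

end

theorem theorem1p1 {m : ℕ} {M : Type*} [TopologicalSpace M] [T2Space M]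
    [SecondCountableTopology M] [ChartedSpace (EuclideanSpace ℝ (Fin (m + 1))) M]
    [IsManifold (𝓡 (m + 1)) ∞ M]
    [RiemannianBundle (fun x : M => TangentSpace (𝓡 (m + 1)) x)]
    [IsContMDiffRiemannianBundle (𝓡 (m + 1)) ∞ (EuclideanSpace ℝ (Fin (m + 1)))
      (fun x : M => TangentSpace (𝓡 (m + 1)) x)]
    [MeasurableSpace M] [BorelSpace M]
    (Ω : Set M) (hΩ : IsOpen Ω) (hΩ' : IsConnected Ω)
    (𝓕 : RiemFol.Foliation m Ω)
    (η : Π x : M, TangentSpace (𝓡 (m + 1)) x) (hη : 𝓕.IsUnitNormal η) :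
    2 * Real.sqrt (RiemFol.fundamentalTone (m + 1) Ω) ≥
      ⨅ F : 𝓕.leaves, ⨅ x : (F : Set M), |𝓕.meanCurvature η (x : M)| := by
  -- all the infima are of sets of nonnegative numbers, so none is a junk value of an unbounded set
  set c := ⨅ F : 𝓕.leaves, ⨅ x : (F : Set M), |𝓕.meanCurvature η (x : M)| with hc
  rcases le_or_gt c 0 with hc0 | hc0
  · exact hc0.trans (by positivity)
  have hH : ∀ x ∈ Ω, c ≤ |𝓕.meanCurvature η x| := by
    intro x hx
    let F : 𝓕.leaves := ⟨𝓕.leaf x, x, hx, rfl⟩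
    have h1 : c ≤ ⨅ y : (F : Set M), |𝓕.meanCurvature η (y : M)| :=
      ciInf_le ⟨0, by rintro _ ⟨F, rfl⟩; exact Real.iInf_nonneg fun _ => abs_nonneg _⟩ F
    exact h1.trans (ciInf_le (f := fun y : (F : Set M) => |𝓕.meanCurvature η (y : M)|)
      ⟨0, by rintro _ ⟨y, rfl⟩; exact abs_nonneg _⟩ ⟨x, Relation.ReflTransGen.refl⟩)
  have htone : (c / 2) ^ 2 ≤ RiemFol.fundamentalTone (m + 1) Ω := by
    refine le_csInf ?_ ?_
    -- the infimum is over a nonempty set, so it is not the junk value `0`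
    · obtain ⟨f, G, hfG, hf0⟩ := RiemFol.exists_isH01_ne_zero (n := m + 1) hΩ hΩ'.nonempty
      exact ⟨_, f, G, hfG, hf0, rfl⟩
    · rintro r ⟨f, G, hfG, hf0, rfl⟩
      exact RiemFol.le_div_of_isH01 hΩ (by positivity)
        (fun φ hφ => hη.sq_mul_integral_le hΩ hΩ'.isPreconnected hc0 hH hφ) hfG hf0
  have := Real.le_sqrt_of_sq_le htone
  change c ≤ _
  linarith
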